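/- Let $b>1$ be an integer and let $A\subset\{0,1,\dots,b-1\}$ contain at least one non-zero element; put $N=\#A$, $s_0=\log_b N$ and $\gamma_j=\sum_{a\in A}a^j$. Call an integer $n\ge 0$ admissible if all digits of its minimal base-$b$ representation belong to $A$. The Dirichlet series $K(s)=\sum_{n>0,\ n\text{ admissible}}n^{-s}$ converges for $\operatorname{Re}s>s_0$ and has a meromorphic continuation $K$ to $\mathbb C$. Let $\lambda_{m}$ ($m\ge0$) be the (possibly zero) residue of $K$ at $s_0-m$. The modified residues $\mu_{m,0}$ are defined as follows. If $1<N<b$, then $$\lambda_{m}=\frac{-(-s_0)_{m+1}}{m!}\,\mu_{m,0},\qquad (x)_n=x(x+1)\cdots(x+n-1).$$ If $N=1$ or $N=b$ (where this relation breaks down), then $(\mu_{m,0})_{m\ge0}$ is by convention the solution with $\mu_{0,0}=1$ of $$(1-b^{-m})\mu_{m,0}=-N^{-1}\sum_{j=1}^m\binom mj b^{-j}\gamma_j\,\mu_{m-j,0}\qquad(m\ge1);$$ thus $\mu_{m,0}=(-f/(b-1))^m$ if $A=\{f\}$, and $\mu_{m,0}$ is the $m$-th Bernoulli number (with $B_1=-\frac12$)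 if $N=b$. Let $\mu$ be the law of $\sum_{j\ge1}X_jb^{-j}$, where the $X_j$ are independent and uniformly distributed on $A$. **Theorem.** 1. $\mu$ is a probability measure on $\mathbb R$ whose support is the Cantor set of all $x=\sum_{j\ge1}d_jb^{-j}$ with every $d_j\in A$. Its moment generating function $E(t)=\int e^{tx}\,d\mu(x)$ ($t\in\mathbb C$) is entire, and $$E(t)=\prod_{j\ge1}\frac{\sum_{a\in A}e^{b^{-j}at}}N .$$ 2. $\mu_{0,0}\neq0$, and the exponential generating series $$B(t)=\mu_{0,0}^{-1}\sum_{m\ge0}\mu_{m,0}\frac{t^m}{m!}$$ converges on every open disc centred at $0$ that contains no zero of $E$ (such discs of positive radius exist). Its sum extends to a meromorphic function $B$ on $\mathbb C$, which is the multiplicative inverse of $E$: the poles of $B$ are exactly the zeros of $E$, and at every $t$ with $E(t)\ne0$, $$B(t)=\lim_{k\to\infty}\frac{N^k}{\sum_{a_1,\dots,a_k\in A}e^{t\sum_{j=1}^kb^{-j}a_j}}=\frac1{E(t)} .$$ 3. If $\operatorname{Re}t<0$, then $|E(t)|<1$, so that $|B(t)|>1$ (where $|B(t)|=\infty$ if $t$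 is a pole of $B$). -/

import Mathlib

open Filter Topology MeasureTheory ProbabilityTheory

namespace RestrictedDirichlet

noncomputable section

/-- A natural number is admissible when all the digits of its (minimal) base-`b` representation
belong to `A`. -/
def Admissible (b : ℕ) (A : Finset ℕ) (n : ℕ) : Prop := ∀ d ∈ Nat.digits b n, d ∈ A

open Classical in
/-- The coefficients of the restricted Dirichlet series `∑' n ^ (-s)`; the term at `n = 0` of an
`LSeries` is always omitted. -/
def coeff (b : ℕ) (A : Finset ℕ) (n : ℕ) : ℂ := if Admissible b A n then 1 else 0

/-- The abscissa of convergence `s₀ = log_b N`, with `N = #A`. -/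
def s0 (b : ℕ) (A : Finset ℕ) : ℝ := Real.logb b A.card

/-- `K` is a meromorphic function on `ℂ` which is the sum of the restricted Dirichlet series
on the half-plane `Re s > s₀`. -/
def IsContinuation (b : ℕ) (A : Finset ℕ) (K : ℂ → ℂ) : Prop :=
  Meromorphic K ∧ ∀ s : ℂ, s0 b A < s.re → LSeriesHasSum (coeff b A) s (K s)

/-- The residue at `z` of a function with an isolated singularity there:
`(2πi)⁻¹ ∮ f(w) dw` over a small circle around `z`. -/
def residue (f : ℂ → ℂ) (z : ℂ) : ℂ :=
  limUnder (𝓝[>] (0 : ℝ))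
    (fun r : ℝ => (2 * (Real.pi : ℂ) * Complex.I)⁻¹ * ∮ w in C(z, r), f w)

/-- The power sums `γ_j = ∑_{a ∈ A} a ^ j`. -/
def powerSum (A : Finset ℕ) (j : ℕ) : ℂ := ∑ a ∈ A, (a : ℂ) ^ j

/-- The solution of
`(1 - b⁻ᵐ) μ_m = - N⁻¹ ∑_{1 ≤ j ≤ m} (m choose j) b⁻ʲ γ_j μ_{m-j}` (`m ≥ 1`) with `μ_0 = 1`.
In the sum below, `i : Fin (m + 1)` stands for `j = i + 1`. -/
def recurrenceSolution (b : ℕ) (A : Finset ℕ) : ℕ → ℂ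
  | 0 => 1
  | m + 1 =>
      (1 - ((b : ℂ) ^ (m + 1))⁻¹)⁻¹ *
        (-((A.card : ℂ)⁻¹ * ∑ i : Fin (m + 1),
          (Nat.choose (m + 1) (i.val + 1) : ℂ) * ((b : ℂ) ^ (i.val + 1))⁻¹ *
            powerSum A (i.val + 1) * recurrenceSolution b A (m - i.val)))

/-- The modified residues `μ_{m,0}` on the real axis. If `1 < N < b` they are determined by
`λ_{m,0} = (-(-s₀)_{m+1} / m!) μ_{m,0}`, where `λ_{m,0}` is the residue of `K` at `s₀ - m` and
`(x)_n = x (x + 1) ⋯ (x + n - 1)`; if `N = 1` or `N = b`, where this relation breaks down, they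
are by convention the solution of the recurrence with `μ_{0,0} = 1`. -/
def modifiedResidue (b : ℕ) (A : Finset ℕ) (K : ℂ → ℂ) (m : ℕ) : ℂ :=
  if A.card = 1 ∨ A.card = b then recurrenceSolution b A m
  else residue K ((s0 b A : ℂ) - m) /
    (-((ascPochhammer ℂ (m + 1)).eval (-(s0 b A : ℂ))) / (m.factorial : ℂ))

/-- The Cantor set of the real numbers having an infinite base-`b` expansion `0.d₁d₂d₃…` with
all digits in `A` (the digit `d j` has weight `b ^ (-(j+1))`). -/
def cantorSet (b : ℕ) (A : Finset ℕ) : Set ℝ :=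
  {x | ∃ d : ℕ → ℕ, (∀ j, d j ∈ A) ∧ HasSum (fun j => (d j : ℝ) / (b : ℝ) ^ (j + 1)) x}

/-- The canonical Cantor measure: the law of `∑_{j ≥ 1} X_j b⁻ʲ`, where the `X_j` are independent
and uniformly distributed on `A`. -/
def cantorMeasure (b : ℕ) (A : Finset ℕ) : Measure ℝ :=
  (Measure.infinitePi (fun _ : ℕ => (uniformOn Set.univ : Measure A))).map
    (fun ω => ∑' j : ℕ, ((ω j : ℕ) : ℝ) / (b : ℝ) ^ (j + 1))

/-- The moment generating function `E(t) = ∫ e^{tx} dμ(x)` of the Cantor measure, for complex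
`t`. -/
def cantorMGF (b : ℕ) (A : Finset ℕ) (t : ℂ) : ℂ :=
  ∫ x : ℝ, Complex.exp (t * x) ∂(cantorMeasure b A)

end

end RestrictedDirichlet

/-! The modified residues and the derivatives of `1/E` at `0` obey the same linear recurrence,
`SatisfiesRecurrence`. Since `1 - b⁻ᵐ ≠ 0` for `m ≥ 1`, a solution is determined by its initial
value (`SatisfiesRecurrence.eq_mul`). So the normalised generating series is the Taylor series of
`1/E`, which converges on every disc where `E` has no zero.

For `1/E`: let `P` be the moment generating function of one digit. Peeling off the first digit gives
`E(t) = P(t/b) E(t/b)`, that is, `P(t/b) E(t)⁻¹ = E(t/b)⁻¹` near `0`. Leibniz' rule at `0` turns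
this into the recurrence (`satisfiesRecurrence_iteratedDeriv`).

For the residues: writing an admissible integer as `a + b n` and expanding `(a + b n)^(-s)` by the
binomial series expresses `(1 - N b^(-s)) K(s)` through the values `K(s + j)`, `j ≥ 1`
(`dirichletSum_split`). These lie to the right of `s`, so the equation continues `K` strip by strip,
and comparing residues at `s₀ - m` gives a recurrence (`residue_recurrence`). The Pochhammer
normalisation changes its coefficients `(-(s₀ - m) choose j)` into `(m choose j)`
(`choose_mul_residueFactor`). If `N = 1` or `N = b`, the recurrence holds by convention. For `1 < N
< b`, `μ_{0,0} ≠ 0` amounts to a genuine pole at `s₀` (`exists_hasSimplePole_s0`). -/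

namespace RestrictedDirichlet

noncomputable section

/-! ### The coding map and the Cantor measure. -/

/-- The real number with base-`b` digits `ω`. -/
def coding (b : ℕ) (A : Finset ℕ) (ω : ℕ → A) : ℝ :=
  ∑' j : ℕ, ((ω j : ℕ) : ℝ) / (b : ℝ) ^ (j + 1)

/-- The expansion with all digits `b - 1`. It majorises every digit series, which gives summability,
continuity of the coding map, and values in `[0, 1]`. -/
theorem hasSum_digit_bound {b : ℕ} (hb : 1 < b) :
    HasSum (fun j : ℕ => ((b : ℝ) - 1) / (b : ℝ) ^ (j + 1)) 1 := by
  have hb' : (1 : ℝ) < b := by exact_mod_cast hb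
  have h := (hasSum_geometric_of_lt_one (r := (b : ℝ)⁻¹) (by positivity)
    (inv_lt_one_of_one_lt₀ hb')).mul_left (((b : ℝ) - 1) / b)
  have h1 : (b : ℝ) - 1 ≠ 0 := by linarith
  have h2 : ((b : ℝ) - 1) / b * (1 - (b : ℝ)⁻¹)⁻¹ = 1 := by
    have : 1 - (b : ℝ)⁻¹ = ((b : ℝ) - 1) / b := by field_simp
    rw [this, mul_inv_cancel₀ (by positivity)]
  rw [h2] at h
  refine h.congr_fun fun j => ?_
  rw [pow_succ, inv_pow]
  field_simp

section Coding

variable {b : ℕ} {A : Finset ℕ}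

theorem digit_le (hAb : ∀ a ∈ A, a < b) (ω : ℕ → A) (j : ℕ) :
    ((ω j : ℕ) : ℝ) / (b : ℝ) ^ (j + 1) ≤ ((b : ℝ) - 1) / (b : ℝ) ^ (j + 1) := by
  have h : (ω j : ℕ) + 1 ≤ b := hAb _ (ω j).2
  have h' : ((ω j : ℕ) : ℝ) + 1 ≤ b := by exact_mod_cast h
  gcongr
  linarith

theorem hasSum_coding (hb : 1 < b) (hAb : ∀ a ∈ A, a < b) (ω : ℕ → A) :
    HasSum (fun j : ℕ => ((ω j : ℕ) : ℝ) / (b : ℝ) ^ (j + 1)) (coding b A ω) :=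
  (Summable.of_nonneg_of_le (fun _ => by positivity) (digit_le hAb ω)
    (hasSum_digit_bound hb).summable).hasSum

theorem coding_nonneg (ω : ℕ → A) : 0 ≤ coding b A ω :=
  tsum_nonneg fun _ => by positivity

theorem coding_le_one (hb : 1 < b) (hAb : ∀ a ∈ A, a < b) (ω : ℕ → A) : coding b A ω ≤ 1 :=
  hasSum_le (digit_le hAb ω) (hasSum_coding hb hAb ω) (hasSum_digit_bound hb)

theorem continuous_coding (hb : 1 < b) (hAb : ∀ a ∈ A, a < b) : Continuous (coding b A) := by
  refine continuous_tsum (fun j => ?_) (hasSum_digit_bound hb).summable fun j ω => ?_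
  · exact (((continuous_of_discreteTopology (f := fun a : A => ((a : ℕ) : ℝ))).comp
      (continuous_apply j))).div_const _
  · rw [Real.norm_of_nonneg (by positivity)]
    exact digit_le hAb ω j

theorem range_coding (hb : 1 < b) (hAb : ∀ a ∈ A, a < b) :
    Set.range (coding b A) = cantorSet b A := by
  ext x
  constructor
  · rintro ⟨ω, rfl⟩
    exact ⟨fun j => ω j, fun j => (ω j).2, hasSum_coding hb hAb ω⟩
  · rintro ⟨d, hd, hx⟩
    exact ⟨fun j => ⟨d j, hd j⟩, hx.tsum_eq⟩

/-- The law of a sequence of independent uniform digits. -/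
def digitMeasure (A : Finset ℕ) : Measure (ℕ → A) :=
  Measure.infinitePi (fun _ : ℕ => (uniformOn Set.univ : Measure A))

theorem isProbabilityMeasure_uniformOn_univ (hne : A.Nonempty) :
    IsProbabilityMeasure (uniformOn Set.univ : Measure A) :=
  have := hne.to_subtype
  isProbabilityMeasure_uniformOn Set.finite_univ Set.univ_nonempty

theorem isProbabilityMeasure_digitMeasure (hne : A.Nonempty) :
    IsProbabilityMeasure (digitMeasure A) := by
  have := isProbabilityMeasure_uniformOn_univ hne
  unfold digitMeasure
  infer_instance

theorem cantorMeasure_eq_map : cantorMeasure b A = (digitMeasure A).map (coding b A) := rfl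

theorem isProbabilityMeasure_cantorMeasure (hb : 1 < b) (hAb : ∀ a ∈ A, a < b)
    (hne : A.Nonempty) : IsProbabilityMeasure (cantorMeasure b A) := by
  have := isProbabilityMeasure_digitMeasure hne
  rw [cantorMeasure_eq_map]
  exact Measure.isProbabilityMeasure_map (continuous_coding hb hAb).measurable.aemeasurable

theorem isClosed_cantorSet (hb : 1 < b) (hAb : ∀ a ∈ A, a < b) : IsClosed (cantorSet b A) := by
  rw [← range_coding hb hAb]
  exact (isCompact_range (continuous_coding hb hAb)).isClosed

theorem uniformOn_univ_singleton_ne_zero (a : A) :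
    (uniformOn Set.univ : Measure A) {a} ≠ 0 := by
  rw [Ne, uniformOn_eq_zero_iff Set.finite_univ]
  simp

/-- A nonempty open set contains a cylinder fixing finitely many digits, and its mass is a finite
product of nonzero masses. -/
theorem digitMeasure_isOpenPosMeasure (hne : A.Nonempty) :
    (digitMeasure A).IsOpenPosMeasure := by
  have := isProbabilityMeasure_uniformOn_univ hne
  refine ⟨fun U hU ⟨ω, hω⟩ => ?_⟩
  obtain ⟨I, u, hu, hIU⟩ := isOpen_pi_iff.1 hU ω hω
  have hsub : Set.pi (I : Set ℕ) (fun i => ({ω i} : Set A)) ⊆ U :=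
    (Set.pi_mono fun i hi => Set.singleton_subset_iff.2 (hu i hi).2).trans hIU
  refine ne_of_gt (lt_of_lt_of_le ?_ (measure_mono hsub))
  rw [digitMeasure, Measure.infinitePi_pi _ (fun _ _ => measurableSet_singleton _)]
  exact pos_iff_ne_zero.2 (Finset.prod_ne_zero_iff.2 fun i _ =>
    uniformOn_univ_singleton_ne_zero (ω i))

/-- The range of the continuous coding map is closed and has full measure. Conversely, an open set
meeting it has a nonempty open preimage, which has positive mass. -/
theorem support_cantorMeasure (hb : 1 < b) (hAb : ∀ a ∈ A, a < b) (hne : A.Nonempty) :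
    (cantorMeasure b A).support = cantorSet b A := by
  have hmeas := (continuous_coding hb hAb).measurable
  have := digitMeasure_isOpenPosMeasure hne
  apply Set.Subset.antisymm
  · refine Measure.support_subset_of_isClosed (isClosed_cantorSet hb hAb) ?_
    rw [cantorMeasure_eq_map, mem_ae_map_iff hmeas.aemeasurable
      (isClosed_cantorSet hb hAb).measurableSet, ← range_coding hb hAb]
    simp
  · rw [← range_coding hb hAb, Measure.support_eq_forall_isOpen]
    rintro _ ⟨ω, rfl⟩ u hu ho
    rw [cantorMeasure_eq_map, Measure.map_apply hmeas ho.measurableSet]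
    exact (ho.preimage (continuous_coding hb hAb)).measure_pos _ ⟨ω, hu⟩

end Coding

/-! ### The moment generating function: product formula, entireness, bounds. -/

/-- The moment generating polynomial of a single digit. -/
def digitMGF (A : Finset ℕ) (t : ℂ) : ℂ := (∑ a ∈ A, Complex.exp (a * t)) / (A.card : ℂ)

section MGF

variable {b : ℕ} {A : Finset ℕ}

theorem integral_uniformOn_univ (f : A → ℂ) :
    ∫ a, f a ∂(uniformOn Set.univ : Measure A) = (∑ a, f a) / (A.card : ℂ) := by
  rw [uniformOn, ProbabilityTheory.cond, Measure.restrict_univ, integral_smul_measure,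
    integral_count]
  simp [Measure.count_apply, div_eq_inv_mul]

theorem cantorMGF_eq_integral (hb : 1 < b) (hAb : ∀ a ∈ A, a < b) (t : ℂ) :
    cantorMGF b A t = ∫ ω, Complex.exp (t * coding b A ω) ∂(digitMeasure A) := by
  rw [cantorMGF, cantorMeasure_eq_map,
    integral_map (continuous_coding hb hAb).measurable.aemeasurable]
  exact (by fun_prop : Continuous fun x : ℝ => Complex.exp (t * x)).aestronglyMeasurable

/-- The integrand depends on the first `k` digits only and factors over them, so independence splits
the integral. -/
theorem integral_exp_partial (hne : A.Nonempty) (t : ℂ) (k : ℕ) :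
    ∫ ω, Complex.exp (t * ((∑ j ∈ Finset.range k, ((ω j : ℕ) : ℝ) / (b : ℝ) ^ (j + 1) : ℝ) : ℂ))
      ∂(digitMeasure A) = ∏ j ∈ Finset.range k, digitMGF A (t / (b : ℂ) ^ (j + 1)) := by
  have := isProbabilityMeasure_uniformOn_univ hne
  let F : ((i : Finset.range k) → A) → ℂ := fun y =>
    ∏ i, Complex.exp (t * ((((y i : ℕ) : ℝ) / (b : ℝ) ^ ((i : ℕ) + 1) : ℝ) : ℂ))
  have hF : ∀ ω : ℕ → A,
      Complex.exp (t * ((∑ j ∈ Finset.range k, ((ω j : ℕ) : ℝ) / (b : ℝ) ^ (j + 1) : ℝ) : ℂ)) =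
        F ((Finset.range k).restrict ω) := by
    intro ω
    simp only [F, Complex.ofReal_sum, Finset.mul_sum, Complex.exp_sum, Finset.restrict]
    exact (Finset.prod_coe_sort (Finset.range k) fun j =>
      Complex.exp (t * ((((ω j : ℕ) : ℝ) / (b : ℝ) ^ (j + 1) : ℝ) : ℂ))).symm
  simp_rw [hF, digitMeasure]
  refine (integral_restrict_infinitePi (X := fun _ => A)
    (μ := fun _ => (uniformOn Set.univ : Measure A)) (f := F)
    (Measurable.of_discrete.aestronglyMeasurable)).trans ?_
  simp only [F]
  rw [integral_fintype_prod_eq_prod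
    (f := fun (i : Finset.range k) (y : A) =>
      Complex.exp (t * ((((y : ℕ) : ℝ) / (b : ℝ) ^ ((i : ℕ) + 1) : ℝ) : ℂ)))]
  rw [← Finset.prod_coe_sort (Finset.range k)]
  refine Finset.prod_congr rfl fun i _ => ?_
  rw [integral_uniformOn_univ, digitMGF, ← Finset.sum_coe_sort A]
  congr 1
  refine Finset.sum_congr rfl fun a _ => ?_
  congr 1
  push_cast
  ring

theorem tendsto_prod_digitMGF (hb : 1 < b) (hAb : ∀ a ∈ A, a < b) (hne : A.Nonempty) (t : ℂ) :
    Tendsto (fun k : ℕ => ∏ j ∈ Finset.range k, digitMGF A (t / (b : ℂ) ^ (j + 1))) atTop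
      (𝓝 (cantorMGF b A t)) := by
  have := isProbabilityMeasure_digitMeasure hne
  simp_rw [← integral_exp_partial (b := b) hne, cantorMGF_eq_integral hb hAb]
  refine tendsto_integral_of_dominated_convergence (fun _ => Real.exp ‖t‖) (fun k => ?_)
    (integrable_const _) (fun k => ?_) ?_
  · refine Continuous.aestronglyMeasurable ?_
    have : ∀ j, Continuous fun ω : ℕ → A => ((ω j : ℕ) : ℝ) := fun j =>
      (continuous_of_discreteTopology (f := fun a : A => ((a : ℕ) : ℝ))).comp (continuous_apply j)
    fun_prop
  · refine Eventually.of_forall fun ω => ?_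
    refine (Complex.norm_exp_le_exp_norm _).trans (Real.exp_le_exp.2 ?_)
    rw [norm_mul, Complex.norm_real, Real.norm_of_nonneg (by positivity)]
    refine mul_le_of_le_one_right (norm_nonneg _) ?_
    exact (sum_le_hasSum _ (fun _ _ => by positivity) (hasSum_coding hb hAb ω)).trans
      (coding_le_one hb hAb ω)
  · refine Eventually.of_forall fun ω => ?_
    have h := (hasSum_coding hb hAb ω).tendsto_sum_nat
    exact (Complex.continuous_exp.tendsto _).comp
      (((Complex.continuous_ofReal.tendsto _).comp h).const_mul t)

theorem cantorMGF_functional (hb : 1 < b) (hAb : ∀ a ∈ A, a < b) (hne : A.Nonempty) (t : ℂ) :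
    cantorMGF b A t = digitMGF A (t / b) * cantorMGF b A (t / b) := by
  have h1 := (tendsto_add_atTop_iff_nat 1).2 (tendsto_prod_digitMGF hb hAb hne t)
  have h2 := (tendsto_prod_digitMGF hb hAb hne (t / b)).const_mul (digitMGF A (t / b))
  refine tendsto_nhds_unique h1 (h2.congr fun k => ?_)
  rw [Finset.prod_range_succ', mul_comm]
  simp only [zero_add, pow_one, div_div]
  congr 1
  refine Finset.prod_congr rfl fun j _ => ?_
  rw [pow_succ' _ (j + 1)]

theorem cantorMGF_zero (hb : 1 < b) (hAb : ∀ a ∈ A, a < b) (hne : A.Nonempty) :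
    cantorMGF b A 0 = 1 := by
  have := isProbabilityMeasure_cantorMeasure hb hAb hne
  simp [cantorMGF]

theorem ae_cantorMeasure_mem_Icc (hb : 1 < b) (hAb : ∀ a ∈ A, a < b) :
    ∀ᵐ x ∂(cantorMeasure b A), x ∈ Set.Icc (0 : ℝ) 1 := by
  rw [cantorMeasure_eq_map, ae_map_iff (continuous_coding hb hAb).measurable.aemeasurable
    (p := fun x => x ∈ Set.Icc (0 : ℝ) 1) measurableSet_Icc]
  exact Eventually.of_forall fun ω => ⟨coding_nonneg ω, coding_le_one hb hAb ω⟩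

/-- The measure lives on `[0, 1]`, so all its exponential moments are finite and the strip of
holomorphy is the whole plane. -/
theorem differentiable_cantorMGF (hb : 1 < b) (hAb : ∀ a ∈ A, a < b) (hne : A.Nonempty) :
    Differentiable ℂ (cantorMGF b A) := by
  have := isProbabilityMeasure_cantorMeasure hb hAb hne
  have huniv : integrableExpSet id (cantorMeasure b A) = Set.univ := by
    refine Set.eq_univ_of_forall fun t => ?_
    refine Integrable.of_bound (C := Real.exp |t|)
      (by fun_prop : Continuous fun x : ℝ => Real.exp (t * id x)).aestronglyMeasurable ?_
    filter_upwards [ae_cantorMeasure_mem_Icc hb hAb] with x hx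
    rw [Real.norm_of_nonneg (Real.exp_pos _).le, Real.exp_le_exp]
    calc t * x ≤ |t| * x := mul_le_mul_of_nonneg_right (le_abs_self t) hx.1
      _ ≤ |t| := mul_le_of_le_one_right (abs_nonneg t) hx.2
  intro z
  exact (hasDerivAt_complexMGF (X := id) (μ := cantorMeasure b A) (z := z)
    (by simp [huniv])).differentiableAt

theorem digitMGF_zero (hne : A.Nonempty) : digitMGF A 0 = 1 := by
  have : (A.card : ℂ) ≠ 0 := by exact_mod_cast hne.card_pos.ne'
  simp [digitMGF, this]

theorem differentiable_digitMGF : Differentiable ℂ (digitMGF A) := by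
  unfold digitMGF
  fun_prop

/-- The factors differ from `1` by `O(b⁻ʲ)`, so the product converges unconditionally; its value is
the limit of the partial products already found. -/
theorem hasProd_cantorMGF (hb : 1 < b) (hAb : ∀ a ∈ A, a < b) (hne : A.Nonempty) (t : ℂ) :
    HasProd (fun j : ℕ => digitMGF A (t / (b : ℂ) ^ (j + 1))) (cantorMGF b A t) := by
  have hb' : (1 : ℝ) < b := by exact_mod_cast hb
  have hO : (fun z => digitMGF A z - 1) =O[𝓝 0] (fun z : ℂ => z) := by
    simpa [digitMGF_zero hne] using
      (differentiable_digitMGF (A := A) 0).isBigO_sub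
  have htend : Tendsto (fun j : ℕ => t / (b : ℂ) ^ (j + 1)) atTop (𝓝 0) := by
    rw [tendsto_zero_iff_norm_tendsto_zero]
    have h := ((tendsto_pow_atTop_nhds_zero_of_lt_one (r := (b : ℝ)⁻¹) (by positivity)
      (inv_lt_one_of_one_lt₀ hb')).comp (tendsto_add_atTop_nat 1)).const_mul ‖t‖
    rw [mul_zero] at h
    refine h.congr fun j => ?_
    simp [div_eq_mul_inv]
  have hs : Summable fun j : ℕ => ‖t / (b : ℂ) ^ (j + 1)‖ := by
    have h := ((hasSum_digit_bound hb).summable).mul_left (‖t‖ / ((b : ℝ) - 1))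
    refine h.congr fun j => ?_
    have : (b : ℝ) - 1 ≠ 0 := by linarith
    simp only [norm_div, norm_pow, Complex.norm_natCast]
    field_simp
  have hsum : Summable fun j : ℕ => ‖digitMGF A (t / (b : ℂ) ^ (j + 1)) - 1‖ :=
    summable_of_isBigO_nat hs ((hO.comp_tendsto htend).norm_norm)
  have hm : Multipliable fun j : ℕ => digitMGF A (t / (b : ℂ) ^ (j + 1)) := by
    simpa using multipliable_one_add_of_summable hsum
  have := tendsto_nhds_unique hm.hasProd.tendsto_prod_nat (tendsto_prod_digitMGF hb hAb hne t)
  exact this ▸ hm.hasProd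

theorem norm_cantorMGF_le_one (hb : 1 < b) (hAb : ∀ a ∈ A, a < b) (hne : A.Nonempty) {t : ℂ}
    (ht : t.re ≤ 0) : ‖cantorMGF b A t‖ ≤ 1 := by
  have := isProbabilityMeasure_cantorMeasure hb hAb hne
  refine (norm_integral_le_of_norm_le_const (C := 1) ?_).trans (by simp)
  filter_upwards [ae_cantorMeasure_mem_Icc hb hAb] with x hx
  rw [Complex.norm_exp, Complex.re_mul_ofReal]
  exact Real.exp_le_one_iff.2 (mul_nonpos_of_nonpos_of_nonneg ht hx.1)

theorem norm_digitMGF_lt_one (hA : ∃ a ∈ A, a ≠ 0) {t : ℂ} (ht : t.re < 0) :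
    ‖digitMGF A t‖ < 1 := by
  obtain ⟨a₀, ha₀, h0⟩ := hA
  have hcard : (0 : ℝ) < A.card := by exact_mod_cast Finset.card_pos.2 ⟨a₀, ha₀⟩
  rw [digitMGF, norm_div, Complex.norm_natCast, div_lt_one hcard]
  refine (norm_sum_le _ _).trans_lt ?_
  have hexp : ∀ a : ℕ, ‖Complex.exp (a * t)‖ = Real.exp (a * t.re) := fun a => by
    rw [Complex.norm_exp]; simp
  simp_rw [hexp]
  calc ∑ a ∈ A, Real.exp (a * t.re) < ∑ a ∈ A, (1 : ℝ) := by
        refine Finset.sum_lt_sum (fun a _ => Real.exp_le_one_iff.2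
          (mul_nonpos_of_nonneg_of_nonpos (by positivity) ht.le)) ⟨a₀, ha₀, ?_⟩
        exact Real.exp_lt_one_iff.2 (mul_neg_of_pos_of_neg (by positivity) ht)
    _ = A.card := by simp

/-- Strictness comes from the first factor alone, through the nonzero digit. The rest is at most `1`
because the measure lives on nonnegative numbers. -/
theorem norm_cantorMGF_lt_one (hb : 1 < b) (hAb : ∀ a ∈ A, a < b) (hA : ∃ a ∈ A, a ≠ 0) {t : ℂ}
    (ht : t.re < 0) : ‖cantorMGF b A t‖ < 1 := by
  have hne : A.Nonempty := hA.imp fun _ h => h.1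
  have hre : (t / b).re < 0 := by
    rw [Complex.div_natCast_re]
    exact div_neg_of_neg_of_pos ht (by positivity)
  rw [cantorMGF_functional hb hAb hne, norm_mul]
  exact mul_lt_one_of_nonneg_of_lt_one_left (norm_nonneg _) (norm_digitMGF_lt_one hA hre)
    (norm_cantorMGF_le_one hb hAb hne hre.le)

/-- Multiplying out the product of `k` digit sums gives one exponential per digit string of length
`k`. -/
theorem prod_digitMGF_eq (t : ℂ) (k : ℕ) :
    (∏ j ∈ Finset.range k, digitMGF A (t / (b : ℂ) ^ (j + 1)))⁻¹ =
      (A.card : ℂ) ^ k / ∑ a ∈ Fintype.piFinset (fun _ : Fin k => A),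
        Complex.exp (t * ∑ j : Fin k, ((b : ℂ) ^ (j.val + 1))⁻¹ * (a j : ℂ)) := by
  rw [← Fin.prod_univ_eq_prod_range (fun j => digitMGF A (t / (b : ℂ) ^ (j + 1)))]
  simp only [digitMGF, Finset.prod_div_distrib, Finset.prod_const, Finset.card_univ,
    Fintype.card_fin, inv_div]
  rw [Finset.prod_univ_sum]
  congr 1
  refine Finset.sum_congr rfl fun a _ => ?_
  rw [Finset.mul_sum, Complex.exp_sum]
  refine Finset.prod_congr rfl fun j _ => ?_
  congr 1
  ring

end MGF

/-! ### The restricted Dirichlet series and the splitting of the last digit. -/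

open Classical in
/-- The indicator function of the positive admissible integers. -/
def weight (b : ℕ) (A : Finset ℕ) (n : ℕ) : ℝ := if n ≠ 0 ∧ Admissible b A n then 1 else 0

section Weight

variable {b : ℕ} {A : Finset ℕ}

@[simp] theorem weight_zero : weight b A 0 = 0 := by simp [weight]

theorem weight_nonneg (n : ℕ) : 0 ≤ weight b A n := by
  unfold weight; split_ifs <;> norm_num

/-- The excluded case `a = n = 0` is special: `0` has no digits, so it is admissible even when `0 ∉
A`. -/
theorem admissible_add_mul (hb : 1 < b) {a n : ℕ} (ha : a < b) (h : a ≠ 0 ∨ n ≠ 0) :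
    Admissible b A (a + b * n) ↔ a ∈ A ∧ Admissible b A n := by
  simp [Admissible, Nat.digits_add b hb a n ha h]

theorem weight_add_mul (hb : 1 < b) {a n : ℕ} (ha : a < b) (hn : n ≠ 0) :
    weight b A (a + b * n) = if a ∈ A then weight b A n else 0 := by
  have h0 : a + b * n ≠ 0 := by
    have := Nat.mul_pos (by omega : 0 < b) (Nat.pos_of_ne_zero hn)
    omega
  unfold weight
  rw [admissible_add_mul hb ha (Or.inr hn)]
  by_cases haA : a ∈ A
  · simp [haA, hn]
    grind
  · simp [haA]

theorem weight_digit (hb : 1 < b) {a : ℕ} (ha : a < b) :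
    weight b A a = if a ∈ A.erase 0 then 1 else 0 := by
  by_cases h0 : a = 0
  · simp [h0]
  · have := admissible_add_mul (A := A) (n := 0) hb ha (Or.inl h0)
    simp only [mul_zero, add_zero] at this
    have h1 : Admissible b A 0 := by simp [Admissible]
    simp [weight, this, h0, h1]

theorem sum_range_ite_mem {E : Type*} [AddCommMonoid E] {B : Finset ℕ} (hB : ∀ a ∈ B, a < b)
    (g : ℕ → E) : ∑ a ∈ Finset.range b, (if a ∈ B then g a else 0) = ∑ a ∈ B, g a := by
  rw [← Finset.sum_filter]
  congr 1
  ext a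
  simp only [Finset.mem_filter, Finset.mem_range]
  exact ⟨fun h => h.2, fun h => ⟨hB a h, h⟩⟩

/-- Splitting off the last digit in a sum over the positive admissible integers. -/
theorem hasSum_weight_split {E : Type*} [NormedAddCommGroup E] [NormedSpace ℝ E]
    (hb : 1 < b) (hAb : ∀ a ∈ A, a < b) {f : ℕ → E} {S : E}
    (h : HasSum (fun n => weight b A n • f n) S) :
    HasSum (fun n => weight b A n • ∑ a ∈ A, f (a + b * n)) (S - ∑ a ∈ A.erase 0, f a) := by
  have : NeZero b := ⟨by omega⟩
  have h1 := ((Nat.divModEquiv b).symm.hasSum_iff.2 h).prod_fiberwise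
    (fun n => hasSum_fintype _)
  have h2 : ∀ n, (∑ a : Fin b, ((fun n => weight b A n • f n) ∘ (Nat.divModEquiv b).symm) (n, a)) =
      ∑ a ∈ Finset.range b, weight b A (a + b * n) • f (a + b * n) := by
    intro n
    rw [← Fin.sum_univ_eq_sum_range (fun a => weight b A (a + b * n) • f (a + b * n))]
    refine Finset.sum_congr rfl fun a _ => ?_
    simp [Nat.divModEquiv, mul_comm, add_comm]
  -- The quotient `n = 0` collects the one-digit integers; their contribution is removed as a series
  -- supported at `0`.
  have h3 : HasSum (Pi.single (M := fun _ => E) 0 (∑ a ∈ A.erase 0, f a))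
      (∑ a ∈ A.erase 0, f a) := by
    convert hasSum_single 0 (f := Pi.single (M := fun _ => E) 0 (∑ a ∈ A.erase 0, f a)) ?_
    · simp
    · intro n hn; simp [hn]
  refine (h1.sub h3).congr_fun fun n => ?_
  rw [h2]
  rcases eq_or_ne n 0 with rfl | hn
  · simp only [mul_zero, add_zero, weight_zero, zero_smul, Pi.single_eq_same]
    rw [← sum_range_ite_mem (b := b) (fun a ha => hAb a (Finset.mem_of_mem_erase ha)), eq_comm,
      sub_eq_zero]
    refine Finset.sum_congr rfl fun a ha => ?_
    rw [weight_digit hb (Finset.mem_range.1 ha)]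
    split_ifs <;> simp
  · rw [Pi.single_eq_of_ne hn, sub_zero, Finset.smul_sum, ← sum_range_ite_mem hAb]
    refine Finset.sum_congr rfl fun a ha => ?_
    rw [weight_add_mul hb (Finset.mem_range.1 ha) hn]
    split_ifs <;> simp

theorem card_mul_rpow_neg (hb : 1 < b) (hne : A.Nonempty) (x : ℝ) :
    (A.card : ℝ) * (b : ℝ) ^ (-x) = (b : ℝ) ^ (s0 b A - x) := by
  have hb' : (1 : ℝ) < b := by exact_mod_cast hb
  have hcard : (0 : ℝ) < A.card := by exact_mod_cast hne.card_pos
  rw [sub_eq_add_neg, Real.rpow_add (by linarith), s0,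
    Real.rpow_logb (by linarith) hb'.ne' hcard]

theorem card_mul_rpow_neg_lt_one (hb : 1 < b) (hne : A.Nonempty) {x : ℝ} (hx : s0 b A < x) :
    (A.card : ℝ) * (b : ℝ) ^ (-x) < 1 := by
  have hb' : (1 : ℝ) < b := by exact_mod_cast hb
  rw [card_mul_rpow_neg hb hne]
  exact Real.rpow_lt_one_of_one_lt_of_neg hb' (by linarith)

theorem s0_nonneg (hb : 1 < b) (hne : A.Nonempty) : 0 ≤ s0 b A :=
  Real.logb_nonneg (by exact_mod_cast hb) (by exact_mod_cast hne.card_pos)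

/-- Convergence of the restricted Dirichlet series to the right of `s₀`. -/
theorem summable_weight_rpow (hb : 1 < b) (hAb : ∀ a ∈ A, a < b) (hne : A.Nonempty) {x : ℝ}
    (hx : s0 b A < x) : Summable fun n : ℕ => weight b A n * (n : ℝ) ^ (-x) := by
  have hx0 : 0 < x := (s0_nonneg hb hne).trans_lt hx
  have hb0 : (0 : ℝ) < b := by positivity
  set q := (A.card : ℝ) * (b : ℝ) ^ (-x) with hq
  have hq1 : q < 1 := card_mul_rpow_neg_lt_one hb hne hx
  set Q := ∑ a ∈ A.erase 0, (a : ℝ) ^ (-x) with hQ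
  have hQ0 : 0 ≤ Q := Finset.sum_nonneg fun a _ => by positivity
  -- Truncating to integers with at most `k` digits makes the sums finite, so the splitting applies
  -- before convergence is known. It yields `S (k + 1) ≤ Q + q * S k` with `q < 1`, hence the
  -- uniform bound `Q / (1 - q)`.
  let f : ℕ → ℕ → ℝ := fun k n => if n < b ^ k then (n : ℝ) ^ (-x) else 0
  have hf0 : ∀ k n, 0 ≤ f k n := fun k n => by
    simp only [f]; split_ifs <;> positivity
  have hfle : ∀ k n, f k n ≤ (n : ℝ) ^ (-x) := fun k n => by
    simp only [f]; split_ifs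
    · exact le_rfl
    · positivity
  let S : ℕ → ℝ := fun k => ∑ n ∈ Finset.range (b ^ k), weight b A n • f k n
  have hS : ∀ k, HasSum (fun n => weight b A n • f k n) (S k) := fun k =>
    hasSum_sum_of_ne_finset_zero fun n hn => by
      rw [Finset.mem_range] at hn
      simp [f, hn]
  have hstep : ∀ k, S (k + 1) ≤ Q + q * S k := by
    intro k
    have h1 := hasSum_weight_split hb hAb (hS (k + 1))
    have h2 := (hS k).mul_left q
    have h3 : S (k + 1) - ∑ a ∈ A.erase 0, f (k + 1) a ≤ q * S k := by
      refine hasSum_le (fun n => ?_) h1 h2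
      rcases eq_or_ne n 0 with rfl | hn
      · simp
      rw [smul_eq_mul, smul_eq_mul, mul_left_comm]
      refine mul_le_mul_of_nonneg_left ?_ (weight_nonneg n)
      have h4 : ∀ a ∈ A, f (k + 1) (a + b * n) ≤ (b : ℝ) ^ (-x) * f k n := by
        intro a _
        by_cases hnk : n < b ^ k
        · have hn0 : (0 : ℝ) < n := by positivity
          simp only [f, hnk, if_true]
          refine (hfle (k + 1) (a + b * n)).trans ?_
          rw [← Real.mul_rpow hb0.le hn0.le]
          refine Real.rpow_le_rpow_of_nonpos (by positivity) ?_ (by linarith)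
          push_cast
          linarith [(Nat.cast_nonneg a : (0 : ℝ) ≤ a)]
        · have : ¬ a + b * n < b ^ (k + 1) := by
            rw [pow_succ']
            have := Nat.mul_le_mul_left b (not_lt.1 hnk)
            omega
          simp only [f, this, hnk, if_false, mul_zero, le_refl]
      calc ∑ a ∈ A, f (k + 1) (a + b * n) ≤ ∑ a ∈ A, (b : ℝ) ^ (-x) * f k n :=
            Finset.sum_le_sum h4
        _ = q * f k n := by rw [Finset.sum_const, nsmul_eq_mul, hq]; ring
    have h5 : ∑ a ∈ A.erase 0, f (k + 1) a ≤ Q := Finset.sum_le_sum fun a _ => hfle _ a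
    linarith
  have hbound : ∀ k, S k ≤ Q / (1 - q) := by
    intro k
    induction k with
    | zero =>
      have : S 0 = 0 := by simp [S]
      rw [this]
      exact div_nonneg hQ0 (by linarith)
    | succ k ih =>
      have hq0 : 0 ≤ q := by positivity
      calc S (k + 1) ≤ Q + q * S k := hstep k
        _ ≤ Q + q * (Q / (1 - q)) := by gcongr
        _ = Q / (1 - q) := by
          have : 1 - q ≠ 0 := by linarith
          field_simp
          ring
  refine summable_of_sum_range_le (c := Q / (1 - q))
    (fun n => mul_nonneg (weight_nonneg n) (by positivity)) fun n => ?_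
  refine le_trans ?_ (hbound n)
  have hnb : n ≤ b ^ n := (Nat.lt_pow_self hb).le
  calc ∑ i ∈ Finset.range n, weight b A i * (i : ℝ) ^ (-x)
      ≤ ∑ i ∈ Finset.range (b ^ n), weight b A i * (i : ℝ) ^ (-x) :=
        Finset.sum_le_sum_of_subset_of_nonneg (Finset.range_mono hnb) fun i _ _ =>
          mul_nonneg (weight_nonneg i) (by positivity)
    _ = S n := by
        refine Finset.sum_congr rfl fun i hi => ?_
        simp [f, Finset.mem_range.1 hi]

theorem norm_weight_smul_cpow (n : ℕ) (s : ℂ) :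
    ‖weight b A n • (n : ℂ) ^ (-s)‖ = weight b A n * (n : ℝ) ^ (-s.re) := by
  rcases Nat.eq_zero_or_pos n with rfl | hn
  · simp
  · rw [norm_smul, Complex.norm_natCast_cpow_of_pos hn, Real.norm_of_nonneg (weight_nonneg n),
      Complex.neg_re]

theorem term_coeff (s : ℂ) (n : ℕ) :
    LSeries.term (coeff b A) s n = weight b A n • (n : ℂ) ^ (-s) := by
  rw [LSeries.term_def]
  rcases eq_or_ne n 0 with rfl | hn
  · simp
  · by_cases h : Admissible b A n <;> simp [weight, coeff, h, hn, Complex.cpow_neg]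

/-- The sum of the restricted Dirichlet series. -/
def dirichletSum (b : ℕ) (A : Finset ℕ) : ℂ → ℂ := LSeries (coeff b A)

theorem LSeriesSummable_coeff (hb : 1 < b) (hAb : ∀ a ∈ A, a < b) (hne : A.Nonempty) {s : ℂ}
    (hs : s0 b A < s.re) : LSeriesSummable (coeff b A) s := by
  refine Summable.of_norm ?_
  simp_rw [term_coeff, norm_weight_smul_cpow]
  exact summable_weight_rpow hb hAb hne hs

theorem hasSum_dirichletSum (hb : 1 < b) (hAb : ∀ a ∈ A, a < b) (hne : A.Nonempty) {s : ℂ}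
    (hs : s0 b A < s.re) :
    HasSum (fun n : ℕ => weight b A n • (n : ℂ) ^ (-s)) (dirichletSum b A s) := by
  have h := (LSeriesSummable_coeff hb hAb hne hs).LSeriesHasSum
  unfold LSeriesHasSum at h
  exact h.congr_fun fun n => (term_coeff s n).symm

theorem analyticAt_dirichletSum (hb : 1 < b) (hAb : ∀ a ∈ A, a < b) (hne : A.Nonempty) {s : ℂ}
    (hs : s0 b A < s.re) : AnalyticAt ℂ (dirichletSum b A) s := by
  refine LSeries_analyticOnNhd (coeff b A) s (lt_of_le_of_lt
    (LSeries.abscissaOfAbsConv_le_of_forall_lt_LSeriesSummable (x := s0 b A) fun y hy => ?_) ?_)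
  · exact LSeriesSummable_coeff hb hAb hne (by simpa using hy)
  · exact_mod_cast hs

theorem norm_dirichletSum_le (hb : 1 < b) (hAb : ∀ a ∈ A, a < b) (hne : A.Nonempty) {s : ℂ}
    {x : ℝ} (hx : s0 b A < x) (hs : x ≤ s.re) :
    ‖dirichletSum b A s‖ ≤ ∑' n : ℕ, weight b A n * (n : ℝ) ^ (-x) := by
  have hsum := summable_weight_rpow hb hAb hne hx
  rw [← (hasSum_dirichletSum hb hAb hne (hx.trans_le hs)).tsum_eq]
  refine tsum_of_norm_bounded hsum.hasSum fun n => ?_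
  rw [norm_weight_smul_cpow]
  rcases Nat.eq_zero_or_pos n with rfl | hn
  · simp
  · exact mul_le_mul_of_nonneg_left
      (Real.rpow_le_rpow_of_exponent_le (by exact_mod_cast hn) (by linarith)) (weight_nonneg n)

end Weight

/-! ### Generalised binomial coefficients and the binomial series. -/

section Binomial

theorem choose_neg_eq_prod (s : ℂ) (j : ℕ) :
    Ring.choose (-s) j = (-1) ^ j * (∏ i ∈ Finset.range j, (s + i)) / (j.factorial : ℂ) := by
  rw [Ring.choose_eq_smul, Polynomial.descPochhammer_smeval_eq_ascPochhammer,
    Polynomial.ascPochhammer_smeval_cast, Polynomial.ascPochhammer_smeval_eq_eval,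
    ← descPochhammer_eval_eq_ascPochhammer, descPochhammer_eval_eq_prod_range]
  rw [smul_eq_mul, div_eq_inv_mul]
  congr 1
  rw [← Finset.card_range j, ← Finset.prod_const, Finset.card_range, ← Finset.prod_mul_distrib]
  exact Finset.prod_congr rfl fun i _ => by ring

theorem differentiable_choose_neg (j : ℕ) : Differentiable ℂ fun s : ℂ => Ring.choose (-s) j := by
  simp_rw [choose_neg_eq_prod]
  fun_prop

/-- Each factor satisfies `‖s + i‖ ≤ R + i`, with equality at `s = R`. This gives a majorant uniform
on a disc. -/
theorem norm_choose_neg_le {s : ℂ} {R : ℝ} (hs : ‖s‖ ≤ R) (j : ℕ) :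
    ‖Ring.choose (-s) j‖ ≤ ‖Ring.choose (-(R : ℂ)) j‖ := by
  simp only [choose_neg_eq_prod, norm_div, norm_mul, norm_pow, norm_neg, norm_one, one_pow,
    one_mul, norm_prod]
  refine div_le_div_of_nonneg_right ?_ (norm_nonneg _)
  refine Finset.prod_le_prod (fun _ _ => norm_nonneg _) fun i _ => ?_
  have hR : 0 ≤ R := (norm_nonneg _).trans hs
  have h2 : ‖(R : ℂ) + (i : ℂ)‖ = R + i := by
    rw [← Complex.ofReal_natCast, ← Complex.ofReal_add, Complex.norm_real,
      Real.norm_of_nonneg (by positivity)]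
  rw [h2]
  refine (norm_add_le _ _).trans ?_
  simpa using hs

theorem summable_norm_choose_mul_pow (z : ℂ) {ρ : ℝ} (h0 : 0 ≤ ρ) (h1 : ρ < 1) :
    Summable fun j : ℕ => ‖Ring.choose z j‖ * ρ ^ j := by
  have h := (binomialSeries ℂ z).summable_norm_mul_pow (r := ⟨ρ, h0⟩)
    (lt_of_lt_of_le (ENNReal.coe_lt_one_iff.2 (NNReal.coe_lt_coe.1 h1))
      binomialSeries_radius_ge_one)
  refine h.congr fun j => ?_
  rw [binomialSeries, FormalMultilinearSeries.ofScalars_norm]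
  rfl

theorem hasSum_choose_mul_pow (z : ℂ) {x : ℂ} (hx : ‖x‖ < 1) :
    HasSum (fun j : ℕ => Ring.choose z j * x ^ j) ((1 + x) ^ z) := by
  have h := (Complex.one_add_cpow_hasFPowerSeriesOnBall_zero (a := z)).hasSum
    (y := x) (by simpa [enorm_eq_nnnorm, ← NNReal.coe_lt_coe] using hx)
  simpa [mul_comm, binomialSeries, FormalMultilinearSeries.coeff_ofScalars] using h

end Binomial

/-! ### The functional equation in the half-plane of convergence. -/

section Step

variable {b : ℕ} {A : Finset ℕ}

/-- The coefficient of `K (s + j)` in the functional equation of the restricted Dirichlet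
series, up to the factor `b ^ (-s)`. -/
def stepCoeff (b : ℕ) (A : Finset ℕ) (s : ℂ) (j : ℕ) : ℂ :=
  Ring.choose (-s) j * ((b : ℂ) ^ j)⁻¹ * powerSum A j

theorem differentiable_stepCoeff (j : ℕ) : Differentiable ℂ fun s => stepCoeff b A s j := by
  have := differentiable_choose_neg j
  unfold stepCoeff
  fun_prop

/-- The ratio of the largest digit by the base. -/
def ratio (b : ℕ) : ℝ := ((b : ℝ) - 1) / b

theorem ratio_nonneg (hb : 1 < b) : 0 ≤ ratio b := by
  have hb' : (1 : ℝ) < b := by exact_mod_cast hb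
  exact div_nonneg (by linarith) (by linarith)

theorem ratio_lt_one (hb : 1 < b) : ratio b < 1 := by
  have hb' : (1 : ℝ) < b := by exact_mod_cast hb
  rw [ratio, div_lt_one (by linarith)]
  linarith

theorem digit_div_le_ratio (hAb : ∀ a ∈ A, a < b) {a : ℕ} (ha : a ∈ A) :
    (a : ℝ) / b ≤ ratio b := by
  have h : a + 1 ≤ b := hAb a ha
  have h' : (a : ℝ) + 1 ≤ b := by exact_mod_cast h
  unfold ratio
  gcongr
  linarith

theorem norm_powerSum_le (hAb : ∀ a ∈ A, a < b) (j : ℕ) :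
    ‖((b : ℂ) ^ j)⁻¹ * powerSum A j‖ ≤ A.card * ratio b ^ j := by
  rw [powerSum, Finset.mul_sum]
  refine (norm_sum_le _ _).trans ?_
  rw [← nsmul_eq_mul, ← Finset.sum_const]
  refine Finset.sum_le_sum fun a ha => ?_
  rw [norm_mul, norm_inv, norm_pow, norm_pow, Complex.norm_natCast, Complex.norm_natCast,
    ← div_eq_inv_mul, ← div_pow]
  exact pow_le_pow_left₀ (by positivity) (digit_div_le_ratio hAb ha) j

theorem norm_stepCoeff_le (hAb : ∀ a ∈ A, a < b) {s : ℂ} {R : ℝ} (hs : ‖s‖ ≤ R) (j : ℕ) :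
    ‖stepCoeff b A s j‖ ≤ A.card * (‖Ring.choose (-(R : ℂ)) j‖ * ratio b ^ j) := by
  rw [stepCoeff, mul_assoc, norm_mul, mul_left_comm]
  gcongr
  · exact norm_choose_neg_le hs j
  · exact norm_powerSum_le hAb j

/-- Factor `(a + b n)^(-s) = (b n)^(-s) (1 + a/(b n))^(-s)`; since `n ≥ 1`, `a/(b n) ≤ (b - 1)/b <
1` and the binomial series applies. -/
theorem hasSum_last_digit (hb : 1 < b) (hAb : ∀ a ∈ A, a < b) (s : ℂ) {n : ℕ} (hn : n ≠ 0) :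
    HasSum (fun j : ℕ => (b : ℂ) ^ (-s) * (stepCoeff b A s j * (n : ℂ) ^ (-(s + j))))
      (∑ a ∈ A, ((a + b * n : ℕ) : ℂ) ^ (-s)) := by
  have hn' : (n : ℂ) ≠ 0 := by exact_mod_cast hn
  have hb' : (b : ℂ) ≠ 0 := by exact_mod_cast (by omega : b ≠ 0)
  have hbR : (0 : ℝ) < b := by exact_mod_cast (by omega : 0 < b)
  have hnR : (1 : ℝ) ≤ n := by exact_mod_cast Nat.one_le_iff_ne_zero.2 hn
  have key : ∀ a ∈ A, HasSum (fun j : ℕ => (b : ℂ) ^ (-s) *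
      (Ring.choose (-s) j * ((b : ℂ) ^ j)⁻¹ * (a : ℂ) ^ j * (n : ℂ) ^ (-(s + j))))
      (((a + b * n : ℕ) : ℂ) ^ (-s)) := by
    intro a ha
    have hx : ‖(a : ℂ) / ((b : ℂ) * n)‖ < 1 := by
      rw [norm_div, norm_mul, Complex.norm_natCast, Complex.norm_natCast, Complex.norm_natCast,
        ← div_div]
      exact (div_le_self (by positivity) hnR).trans_lt
        ((digit_div_le_ratio hAb ha).trans_lt (ratio_lt_one hb))
    have h := (hasSum_choose_mul_pow (-s) hx).mul_left (((b : ℂ) * n) ^ (-s))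
    have h1 : ((b : ℂ) * n) ^ (-s) * (1 + (a : ℂ) / ((b : ℂ) * n)) ^ (-s) =
        ((a + b * n : ℕ) : ℂ) ^ (-s) := by
      have e1 : ((b : ℂ) * n) = (((b : ℝ) * n : ℝ) : ℂ) := by push_cast; rfl
      have e2 : (1 + (a : ℂ) / ((b : ℂ) * n)) = ((1 + (a : ℝ) / ((b : ℝ) * n) : ℝ) : ℂ) := by
        push_cast; rfl
      rw [e2, e1, ← Complex.mul_cpow_ofReal_nonneg (by positivity) (by positivity)]
      congr 1
      push_cast
      field_simp
      ring
    rw [h1] at h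
    refine h.congr_fun fun j => ?_
    rw [Complex.natCast_mul_natCast_cpow, neg_add, Complex.cpow_add _ _ hn',
      Complex.cpow_neg _ (j : ℂ),
      Complex.cpow_natCast, div_pow, mul_pow]
    field_simp
  refine (hasSum_sum key).congr_fun fun j => ?_
  rw [stepCoeff, powerSum, Finset.mul_sum, Finset.sum_mul, Finset.mul_sum]

/-- The functional equation of the restricted Dirichlet series, in its half-plane of
convergence. -/
theorem dirichletSum_split (hb : 1 < b) (hAb : ∀ a ∈ A, a < b) (hne : A.Nonempty) {s : ℂ}
    (hs : s0 b A < s.re) :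
    HasSum (fun j : ℕ => (b : ℂ) ^ (-s) * (stepCoeff b A s j * dirichletSum b A (s + j)))
      (dirichletSum b A s - ∑ a ∈ A.erase 0, (a : ℂ) ^ (-s)) := by
  have hsplit := hasSum_weight_split hb hAb (hasSum_dirichletSum hb hAb hne hs)
  -- The double family over `n` and the binomial index `j` is absolutely summable, being dominated
  -- by a product of two convergent series. Summing rows first gives the split series, columns first
  -- the shifted Dirichlet series.
  let G : ℕ × ℕ → ℂ := fun p =>
    weight b A p.1 • ((b : ℂ) ^ (-s) * (stepCoeff b A s p.2 * (p.1 : ℂ) ^ (-(s + p.2))))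
  have hG : Summable G := by
    have h1 := (summable_weight_rpow hb hAb hne hs).mul_of_nonneg
      (summable_norm_choose_mul_pow (-(‖s‖ : ℂ)) (ratio_nonneg hb) (ratio_lt_one hb))
      (fun n => mul_nonneg (weight_nonneg n) (by positivity))
      (fun j => mul_nonneg (norm_nonneg _) (pow_nonneg (ratio_nonneg hb) j))
    refine Summable.of_norm_bounded (h1.mul_left (‖(b : ℂ) ^ (-s)‖ * A.card)) fun p => ?_
    obtain ⟨n, j⟩ := p
    have hwn := weight_nonneg (b := b) (A := A) n
    rcases Nat.eq_zero_or_pos n with rfl | hn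
    · simp [G]
    have hn1 : (1 : ℝ) ≤ n := by exact_mod_cast hn
    simp only [G]
    rw [norm_smul, norm_mul, norm_mul, Complex.norm_natCast_cpow_of_pos hn,
      Real.norm_of_nonneg hwn]
    have h2 := norm_stepCoeff_le hAb (le_refl ‖s‖) j
    have h3 : (n : ℝ) ^ (-(s + (j : ℂ))).re ≤ (n : ℝ) ^ (-s.re) :=
      Real.rpow_le_rpow_of_exponent_le hn1 (by simp)
    calc weight b A n * (‖(b : ℂ) ^ (-s)‖ * (‖stepCoeff b A s j‖ * (n : ℝ) ^ (-(s + (j : ℂ))).re))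
        ≤ weight b A n * (‖(b : ℂ) ^ (-s)‖ *
          ((A.card * (‖Ring.choose (-(‖s‖ : ℂ)) j‖ * ratio b ^ j)) * (n : ℝ) ^ (-s.re))) := by
          gcongr
          exact mul_nonneg (by positivity)
            (mul_nonneg (norm_nonneg _) (pow_nonneg (ratio_nonneg hb) j))
      _ = _ := by ring
  have hrow : ∀ n, HasSum (fun j => G (n, j))
      (weight b A n • ∑ a ∈ A, ((a + b * n : ℕ) : ℂ) ^ (-s)) := by
    intro n
    rcases eq_or_ne n 0 with rfl | hn
    · simp [G, hasSum_zero]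
    · exact (hasSum_last_digit hb hAb s hn).const_smul _
  have htot : HasSum G (dirichletSum b A s - ∑ a ∈ A.erase 0, (a : ℂ) ^ (-s)) := by
    rw [← (hG.hasSum.prod_fiberwise hrow).unique hsplit]
    exact hG.hasSum
  have hcomm := (Equiv.prodComm ℕ ℕ).hasSum_iff.2 htot
  refine hcomm.prod_fiberwise fun j => ?_
  have hsj : s0 b A < (s + j).re := by
    simp only [Complex.add_re, Complex.natCast_re]
    linarith [(Nat.cast_nonneg j : (0 : ℝ) ≤ j)]
  have h := ((hasSum_dirichletSum hb hAb hne hsj).mul_left (stepCoeff b A s j)).mul_left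
    ((b : ℂ) ^ (-s))
  refine h.congr_fun fun n => ?_
  simp [G]
  ring

end Step

/-! ### Meromorphic continuation and its uniqueness. -/

section Continuation

variable {b : ℕ} {A : Finset ℕ}

/-- The factor `1 - N b ^ (-s)` of the functional equation. -/
def eulerFactor (b : ℕ) (A : Finset ℕ) (s : ℂ) : ℂ := 1 - A.card * (b : ℂ) ^ (-s)

/-- The right-hand side of the functional equation `K = step K`. -/
def step (b : ℕ) (A : Finset ℕ) (F : ℂ → ℂ) (s : ℂ) : ℂ :=
  (eulerFactor b A s)⁻¹ * (∑ a ∈ A.erase 0, (a : ℂ) ^ (-s) +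
    (b : ℂ) ^ (-s) * ∑' j : ℕ, stepCoeff b A s (j + 1) * F (s + (j + 1 : ℕ)))

theorem stepCoeff_zero (s : ℂ) : stepCoeff b A s 0 = A.card := by
  simp [stepCoeff, powerSum]

theorem base_cast_ne_zero (hb : 1 < b) : (b : ℂ) ≠ 0 := by
  exact_mod_cast (by omega : b ≠ 0)

theorem differentiable_natCast_cpow_neg {n : ℕ} (hn : n ≠ 0) :
    Differentiable ℂ fun s : ℂ => (n : ℂ) ^ (-s) := by
  intro s
  exact (differentiableAt_id.neg).const_cpow (Or.inl (by exact_mod_cast hn))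

theorem differentiable_eulerFactor (hb : 1 < b) : Differentiable ℂ (eulerFactor b A) :=
  ((differentiable_natCast_cpow_neg (by omega : b ≠ 0)).const_mul _).const_sub 1

theorem eulerFactor_ne_zero (hb : 1 < b) (hne : A.Nonempty) {s : ℂ} (hs : s0 b A < s.re) :
    eulerFactor b A s ≠ 0 := by
  intro h
  have h1 : (A.card : ℂ) * (b : ℂ) ^ (-s) = 1 := (sub_eq_zero.1 h).symm
  have h2 := congrArg norm h1
  rw [norm_mul, Complex.norm_natCast, Complex.norm_natCast_cpow_of_pos (by omega), norm_one,
    Complex.neg_re] at h2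
  exact (card_mul_rpow_neg_lt_one hb hne hs).ne h2

theorem dirichletSum_functional (hb : 1 < b) (hAb : ∀ a ∈ A, a < b) (hne : A.Nonempty) {s : ℂ}
    (hs : s0 b A < s.re) :
    eulerFactor b A s * dirichletSum b A s = ∑ a ∈ A.erase 0, (a : ℂ) ^ (-s) +
      (b : ℂ) ^ (-s) * ∑' j : ℕ, stepCoeff b A s (j + 1) * dirichletSum b A (s + (j + 1 : ℕ)) := by
  have h := (hasSum_nat_add_iff' 1).2 (dirichletSum_split hb hAb hne hs)
  have h1 := h.tsum_eq
  rw [tsum_mul_left] at h1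
  rw [h1, eulerFactor]
  simp only [Finset.sum_range_one, stepCoeff_zero, Nat.cast_zero, add_zero]
  ring

theorem step_dirichletSum (hb : 1 < b) (hAb : ∀ a ∈ A, a < b) (hne : A.Nonempty) {s : ℂ}
    (hs : s0 b A < s.re) : step b A (dirichletSum b A) s = dirichletSum b A s := by
  rw [step, ← dirichletSum_functional hb hAb hne hs,
    inv_mul_cancel_left₀ (eulerFactor_ne_zero hb hne hs)]

/-- `step` reads its argument only at `s + 1, s + 2, …`, so each iteration is correct on one further
unit strip to the left. -/
theorem step_congr {F G : ℂ → ℂ} {s : ℂ}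
    (h : ∀ j : ℕ, F (s + (j + 1 : ℕ)) = G (s + (j + 1 : ℕ))) : step b A F s = step b A G s := by
  simp only [step, h]

/-- The iterates of the functional equation, starting from the Dirichlet series. -/
def approx (b : ℕ) (A : Finset ℕ) (m : ℕ) : ℂ → ℂ := (step b A)^[m] (dirichletSum b A)

theorem approx_succ (m : ℕ) : approx b A (m + 1) = step b A (approx b A m) :=
  Function.iterate_succ_apply' _ _ _

theorem approx_succ_apply (hb : 1 < b) (hAb : ∀ a ∈ A, a < b) (hne : A.Nonempty) (m : ℕ) {s : ℂ}
    (hs : s0 b A - m < s.re) : approx b A (m + 1) s = approx b A m s := by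
  induction m generalizing s with
  | zero => exact step_dirichletSum hb hAb hne (by simpa using hs)
  | succ m ih =>
    rw [approx_succ (m + 1)]
    conv_rhs => rw [approx_succ m]
    refine step_congr fun j => ih ?_
    push_cast at hs ⊢
    simp only [Complex.add_re, Complex.natCast_re, Complex.one_re]
    linarith [(Nat.cast_nonneg j : (0 : ℝ) ≤ j)]

theorem approx_apply_of_le (hb : 1 < b) (hAb : ∀ a ∈ A, a < b) (hne : A.Nonempty) {m k : ℕ}
    (hmk : m ≤ k) {s : ℂ} (hs : s0 b A - m < s.re) : approx b A k s = approx b A m s := by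
  induction k, hmk using Nat.le_induction with
  | base => rfl
  | succ k hmk ih =>
    rw [approx_succ_apply hb hAb hne k, ih]
    have : (m : ℝ) ≤ k := by exact_mod_cast hmk
    linarith

/-- The meromorphic continuation of the restricted Dirichlet series. -/
def continuation (b : ℕ) (A : Finset ℕ) (s : ℂ) : ℂ := approx b A (⌊s0 b A - s.re⌋₊ + 1) s

theorem continuation_eq_approx (hb : 1 < b) (hAb : ∀ a ∈ A, a < b) (hne : A.Nonempty) {m : ℕ}
    {s : ℂ} (hs : s0 b A - m < s.re) : continuation b A s = approx b A m s := by
  have h := Nat.lt_floor_add_one (s0 b A - s.re)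
  have h' : s0 b A - ((⌊s0 b A - s.re⌋₊ + 1 : ℕ) : ℝ) < s.re := by push_cast; linarith
  rcases le_total m (⌊s0 b A - s.re⌋₊ + 1) with hm | hm
  · exact approx_apply_of_le hb hAb hne hm hs
  · exact (approx_apply_of_le hb hAb hne hm h').symm

theorem continuation_eq_dirichletSum (hb : 1 < b) (hAb : ∀ a ∈ A, a < b) (hne : A.Nonempty)
    {s : ℂ} (hs : s0 b A < s.re) : continuation b A s = dirichletSum b A s :=
  continuation_eq_approx hb hAb hne (m := 0) (by simpa using hs)

/-- The `+ 1` in `continuation` makes its value always the output of a `step`. So the identity holds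
even at zeros of `eulerFactor`, where the inverse is `0` by convention. -/
theorem continuation_functional (hb : 1 < b) (hAb : ∀ a ∈ A, a < b) (hne : A.Nonempty) (s : ℂ) :
    continuation b A s = step b A (continuation b A) s := by
  rw [continuation, approx_succ]
  refine step_congr fun j => (continuation_eq_approx hb hAb hne ?_).symm
  have h := Nat.lt_floor_add_one (s0 b A - s.re)
  simp only [Complex.add_re, Complex.natCast_re]
  push_cast
  linarith [(Nat.cast_nonneg j : (0 : ℝ) ≤ j)]

/-- Near any point, the functional equation involves finitely many values of the continuation
up to an analytic function. -/
theorem exists_local_functional (hb : 1 < b) (hAb : ∀ a ∈ A, a < b) (hne : A.Nonempty) (M : ℕ)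
    {z : ℂ} (hz : s0 b A - M - 1 / 2 < z.re) :
    ∃ T : ℂ → ℂ, AnalyticAt ℂ T z ∧ ∀ᶠ s in 𝓝 z, continuation b A s =
      (eulerFactor b A s)⁻¹ * (T s + ∑ j ∈ Finset.range M,
        (b : ℂ) ^ (-s) * stepCoeff b A s (j + 1) * continuation b A (s + (j + 1 : ℕ))) := by
  set R : ℝ := ‖z‖ + 1 with hR
  -- On `U` the terms past the first `M` evaluate the series at real part at least `s₀ + 1/2`, where
  -- it is uniformly bounded. Boundedness of `U` controls the binomial coefficients, so the tail is
  -- analytic by the Weierstrass test.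
  set U : Set ℂ := {s | s0 b A - M - 1 / 2 < s.re} ∩ Metric.ball 0 R with hU
  have hUo : IsOpen U :=
    (isOpen_lt continuous_const Complex.continuous_re).inter Metric.isOpen_ball
  have hzU : z ∈ U := ⟨hz, by simp [hR]⟩
  let t : ℕ → ℂ → ℂ := fun j s =>
    stepCoeff b A s (j + M + 1) * dirichletSum b A (s + (j + M + 1 : ℕ))
  have hre : ∀ j : ℕ, ∀ s ∈ U, s0 b A + 1 / 2 ≤ (s + (j + M + 1 : ℕ)).re := by
    intro j s hs
    have h1 : s0 b A - M - 1 / 2 < s.re := hs.1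
    simp only [Complex.add_re, Complex.natCast_re]
    push_cast
    linarith [(Nat.cast_nonneg j : (0 : ℝ) ≤ j)]
  have hhalf : s0 b A < s0 b A + 1 / 2 := by linarith
  set C := ∑' n : ℕ, weight b A n * (n : ℝ) ^ (-(s0 b A + 1 / 2)) with hC
  let u : ℕ → ℝ := fun j =>
    A.card * (‖Ring.choose (-(R : ℂ)) (j + M + 1)‖ * ratio b ^ (j + M + 1)) * C
  have hu : Summable u := by
    have h := summable_norm_choose_mul_pow (-(R : ℂ)) (ratio_nonneg hb) (ratio_lt_one hb)
    exact (((summable_nat_add_iff (M + 1)).2 h).mul_left _).mul_right _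
  have hbound : ∀ j, ∀ s ∈ U, ‖t j s‖ ≤ u j := by
    intro j s hs
    have h1 : ‖s‖ ≤ R := by simpa using (Metric.mem_ball.1 hs.2).le
    simp only [t, u]
    rw [norm_mul]
    refine mul_le_mul (norm_stepCoeff_le hAb h1 _)
      (norm_dirichletSum_le hb hAb hne hhalf (hre j s hs)) (norm_nonneg _) ?_
    exact mul_nonneg (by positivity)
      (mul_nonneg (norm_nonneg _) (pow_nonneg (ratio_nonneg hb) _))
  have hdiff : ∀ j, DifferentiableOn ℂ (t j) U := by
    intro j s hs
    have h1 := (analyticAt_dirichletSum hb hAb hne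
      (hhalf.trans_le (hre j s hs))).differentiableAt
    have h2 : DifferentiableAt ℂ (fun s => dirichletSum b A (s + (j + M + 1 : ℕ))) s :=
      h1.comp s (by fun_prop)
    exact ((differentiable_stepCoeff (j + M + 1) s).mul h2).differentiableWithinAt
  have hsum : DifferentiableOn ℂ (fun s => ∑' j, t j s) U :=
    Complex.differentiableOn_tsum_of_summable_norm hu hdiff hUo hbound
  have hbne : b ≠ 0 := by omega
  refine ⟨fun s => ∑ a ∈ A.erase 0, (a : ℂ) ^ (-s) + (b : ℂ) ^ (-s) * ∑' j, t j s, ?_, ?_⟩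
  · refine AnalyticAt.add ?_ ?_
    · refine Finset.analyticAt_fun_sum _ fun a ha => ?_
      exact (differentiable_natCast_cpow_neg (Finset.ne_of_mem_erase ha)).analyticAt z
    · exact ((differentiable_natCast_cpow_neg hbne).analyticAt z).mul
        (hsum.analyticAt (hUo.mem_nhds hzU))
  · filter_upwards [hUo.mem_nhds hzU] with s hs
    have htail : ∀ j, stepCoeff b A s (j + M + 1) * continuation b A (s + (j + M + 1 : ℕ)) =
        t j s := fun j => by
      rw [continuation_eq_dirichletSum hb hAb hne (hhalf.trans_le (hre j s hs))]
    have hsumm : Summable fun j : ℕ =>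
        stepCoeff b A s (j + 1) * continuation b A (s + (j + 1 : ℕ)) := by
      rw [← summable_nat_add_iff M]
      simp_rw [htail]
      exact Summable.of_norm_bounded hu fun j => hbound j s hs
    rw [continuation_functional hb hAb hne s, step, ← hsumm.sum_add_tsum_nat_add M]
    simp_rw [htail]
    congr 1
    simp_rw [mul_assoc]
    rw [← Finset.mul_sum]
    ring

theorem meromorphicAt_comp_add_const {f : ℂ → ℂ} {z c : ℂ} (h : MeromorphicAt f (z + c)) :
    MeromorphicAt (fun s => f (s + c)) z :=
  h.comp_analyticAt (f := f) (g := fun s => s + c) (by fun_prop)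

theorem meromorphic_continuation (hb : 1 < b) (hAb : ∀ a ∈ A, a < b) (hne : A.Nonempty) :
    Meromorphic (continuation b A) := by
  have key : ∀ (M : ℕ) (z : ℂ), s0 b A - M < z.re → MeromorphicAt (continuation b A) z := by
    intro M
    induction M with
    | zero =>
      intro z hz
      obtain ⟨T, hT, hev⟩ := exists_local_functional hb hAb hne 0 (z := z)
        (by push_cast at hz ⊢; linarith)
      have h1 : MeromorphicAt (fun s => (eulerFactor b A s)⁻¹ * T s) z :=
        ((differentiable_eulerFactor hb).analyticAt z).meromorphicAt.inv.mul hT.meromorphicAt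
      refine h1.congr (EventuallyEq.filter_mono ?_ nhdsWithin_le_nhds)
      filter_upwards [hev] with s hs
      simp [hs]
    | succ M ih =>
      intro z hz
      obtain ⟨T, hT, hev⟩ := exists_local_functional hb hAb hne (M + 1) (z := z) (by linarith)
      have h1 : MeromorphicAt (fun s => (eulerFactor b A s)⁻¹ * (T s +
          ∑ j ∈ Finset.range (M + 1), (b : ℂ) ^ (-s) * stepCoeff b A s (j + 1) *
            continuation b A (s + (j + 1 : ℕ)))) z := by
        refine ((differentiable_eulerFactor hb).analyticAt z).meromorphicAt.inv.mul
          (hT.meromorphicAt.add (MeromorphicAt.fun_sum fun j _ => ?_))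
        refine MeromorphicAt.mul ?_ (meromorphicAt_comp_add_const (ih _ ?_))
        · exact (((differentiable_natCast_cpow_neg (by omega : b ≠ 0)).mul
            (differentiable_stepCoeff (j + 1))).analyticAt z).meromorphicAt
        · simp only [Complex.add_re, Complex.natCast_re]
          push_cast at hz ⊢
          linarith [(Nat.cast_nonneg j : (0 : ℝ) ≤ j)]
      refine h1.congr (EventuallyEq.filter_mono ?_ nhdsWithin_le_nhds)
      filter_upwards [hev] with s hs
      exact hs.symm
  intro z
  refine key (⌊s0 b A - z.re⌋₊ + 1) z ?_
  have h := Nat.lt_floor_add_one (s0 b A - z.re)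
  push_cast
  linarith

theorem isContinuation_continuation (hb : 1 < b) (hAb : ∀ a ∈ A, a < b) (hne : A.Nonempty) :
    IsContinuation b A (continuation b A) := by
  refine ⟨meromorphic_continuation hb hAb hne, fun s hs => ?_⟩
  rw [continuation_eq_dirichletSum hb hAb hne hs]
  exact (LSeriesSummable_coeff hb hAb hne hs).LSeriesHasSum

/-- Two meromorphic functions on the plane that agree on a half-plane agree near every point. -/
theorem eventuallyEq_of_meromorphic_of_eq_halfPlane {f g : ℂ → ℂ} (hf : Meromorphic f)
    (hg : Meromorphic g) {x : ℝ} (h : ∀ s : ℂ, x < s.re → f s = g s) (z : ℂ) :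
    f =ᶠ[𝓝[≠] z] g := by
  have hfg : Meromorphic (f - g) := hf.sub hg
  have hw : meromorphicOrderAt (f - g) ((x + 1 : ℝ) : ℂ) = ⊤ := by
    rw [meromorphicOrderAt_eq_top_iff]
    refine Filter.Eventually.filter_mono nhdsWithin_le_nhds ?_
    have ho : IsOpen {s : ℂ | x < s.re} := isOpen_lt continuous_const Complex.continuous_re
    filter_upwards [ho.mem_nhds (show x < (((x + 1 : ℝ) : ℂ)).re by simp)] with s hs
    simp [h s hs]
  -- Identity theorem: infinite order at one point of the connected plane forces infinite order
  -- everywhere.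
  have hz : meromorphicOrderAt (f - g) z = ⊤ := by
    by_contra hz
    exact hfg.exists_meromorphicOrderAt_ne_top_iff_forall.1 ⟨z, hz⟩ _ hw
  rw [meromorphicOrderAt_eq_top_iff] at hz
  filter_upwards [hz] with s hs
  simpa [sub_eq_zero] using hs

theorem IsContinuation.eventuallyEq (hb : 1 < b) (hAb : ∀ a ∈ A, a < b) (hne : A.Nonempty)
    {K : ℂ → ℂ} (hK : IsContinuation b A K) (z : ℂ) : K =ᶠ[𝓝[≠] z] continuation b A := by
  refine eventuallyEq_of_meromorphic_of_eq_halfPlane hK.1 (meromorphic_continuation hb hAb hne)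
    (x := s0 b A)
    (fun s hs => ?_) z
  have h := isContinuation_continuation hb hAb hne
  exact HasSum.unique (hK.2 s hs) (h.2 s hs)

end Continuation

/-! ### Calculus of simple poles and residues. -/

/-- `f` has at most a simple pole at `z`, with residue `c`. -/
def HasSimplePole (f : ℂ → ℂ) (z c : ℂ) : Prop :=
  ∃ g : ℂ → ℂ, AnalyticAt ℂ g z ∧ g z = c ∧ ∀ᶠ s in 𝓝[≠] z, f s = (s - z)⁻¹ * g s

namespace HasSimplePole

variable {f f₁ f₂ h : ℂ → ℂ} {z c c₁ c₂ : ℂ}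

theorem congr (hf : HasSimplePole f₁ z c) (h : f₂ =ᶠ[𝓝[≠] z] f₁) : HasSimplePole f₂ z c := by
  obtain ⟨g, hg, hc, hev⟩ := hf
  exact ⟨g, hg, hc, by filter_upwards [hev, h] with s h1 h2; rw [h2, h1]⟩

theorem add (h₁ : HasSimplePole f₁ z c₁) (h₂ : HasSimplePole f₂ z c₂) :
    HasSimplePole (fun s => f₁ s + f₂ s) z (c₁ + c₂) := by
  obtain ⟨g₁, hg₁, rfl, hev₁⟩ := h₁
  obtain ⟨g₂, hg₂, rfl, hev₂⟩ := h₂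
  refine ⟨g₁ + g₂, hg₁.add hg₂, rfl, ?_⟩
  filter_upwards [hev₁, hev₂] with s e₁ e₂
  simp only [e₁, e₂, Pi.add_apply]
  ring

theorem analytic_mul (hh : AnalyticAt ℂ h z) (hf : HasSimplePole f z c) :
    HasSimplePole (fun s => h s * f s) z (h z * c) := by
  obtain ⟨g, hg, rfl, hev⟩ := hf
  refine ⟨h * g, hh.mul hg, rfl, ?_⟩
  filter_upwards [hev] with s e
  simp only [e, Pi.mul_apply]
  ring

theorem of_analyticAt (hh : AnalyticAt ℂ h z) : HasSimplePole h z 0 := by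
  refine ⟨fun s => (s - z) * h s, by fun_prop, by simp, ?_⟩
  filter_upwards [self_mem_nhdsWithin] with s hs
  rw [inv_mul_cancel_left₀ (sub_ne_zero.2 hs)]

theorem sum {ι : Type*} (I : Finset ι) {F : ι → ℂ → ℂ} {r : ι → ℂ}
    (h : ∀ i ∈ I, HasSimplePole (F i) z (r i)) :
    HasSimplePole (fun s => ∑ i ∈ I, F i s) z (∑ i ∈ I, r i) := by
  classical
  induction I using Finset.induction_on with
  | empty => simpa using of_analyticAt (h := fun _ => 0) analyticAt_const
  | insert i I hi ih =>
    simp only [Finset.sum_insert hi]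
    exact (h i (Finset.mem_insert_self i I)).add
      (ih fun j hj => h j (Finset.mem_insert_of_mem hj))

theorem comp_add_const {w : ℂ} (hf : HasSimplePole f (z + w) c) :
    HasSimplePole (fun s => f (s + w)) z c := by
  obtain ⟨g, hg, rfl, hev⟩ := hf
  refine ⟨fun s => g (s + w), hg.fun_comp (f := fun s => s + w) (by fun_prop), rfl, ?_⟩
  have ht : Tendsto (fun s : ℂ => s + w) (𝓝[≠] z) (𝓝[≠] (z + w)) :=
    tendsto_nhdsWithin_of_tendsto_nhds_of_eventually_within _
      (((continuous_add_const w).tendsto z).mono_left nhdsWithin_le_nhds)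
      (by filter_upwards [self_mem_nhdsWithin] with s hs; simpa using hs)
  filter_upwards [ht.eventually hev] with s e
  rw [e, add_sub_add_right_eq_sub]

/-- By Cauchy's formula for `g` the normalised circle integral equals `g z` for every small radius,
so its limit is that of a constant. -/
theorem residue_eq (hf : HasSimplePole f z c) : residue f z = c := by
  obtain ⟨g, hg, rfl, hev⟩ := hf
  refine Tendsto.limUnder_eq (tendsto_const_nhds.congr' ?_)
  obtain ⟨ε₁, hε₁, h₁⟩ := Metric.eventually_nhds_iff.1 hg.eventually_analyticAt
  obtain ⟨ε₂, hε₂, h₂⟩ := Metric.eventually_nhds_iff.1 (eventually_nhdsWithin_iff.1 hev)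
  filter_upwards [Ioo_mem_nhdsGT (lt_min hε₁ hε₂)] with r hr
  have hr0 : 0 < r := hr.1
  have hr1 : r < ε₁ := hr.2.trans_le (min_le_left _ _)
  have hr2 : r < ε₂ := hr.2.trans_le (min_le_right _ _)
  have hd : DifferentiableOn ℂ g (Metric.closedBall z r) := fun s hs =>
    (h₁ ((Metric.mem_closedBall.1 hs).trans_lt hr1)).differentiableAt.differentiableWithinAt
  have hint := hd.circleIntegral_sub_inv_smul (Metric.mem_ball_self hr0)
  have hcongr : (∮ w in C(z, r), f w) = ∮ w in C(z, r), (w - z)⁻¹ • g w := by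
    refine circleIntegral.integral_congr hr0.le fun s hs => ?_
    rw [mem_sphere_iff_norm] at hs
    refine h₂ (by rwa [dist_eq_norm, hs]) ?_
    rintro rfl
    simp at hs
    exact hr0.ne hs
  rw [hcongr, hint, smul_eq_mul, inv_mul_cancel_left₀]
  simp [Real.pi_ne_zero]

end HasSimplePole

/-! ### Residues at `s₀ - m` and their recurrence. -/

section Residues

variable {b : ℕ} {A : Finset ℕ}

theorem card_mul_cpow_neg (hb : 1 < b) (hne : A.Nonempty) (m : ℕ) :
    (A.card : ℂ) * (b : ℂ) ^ (-((s0 b A : ℂ) - m)) = (b : ℂ) ^ m := by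
  have h := card_mul_rpow_neg hb hne (s0 b A - m)
  rw [sub_sub_cancel, Real.rpow_natCast] at h
  have h' := congrArg (fun x : ℝ => (x : ℂ)) h
  simp only [Complex.ofReal_mul, Complex.ofReal_natCast, Complex.ofReal_pow] at h'
  rw [← h', Complex.ofReal_cpow (by positivity)]
  push_cast
  rfl

theorem hasDerivAt_eulerFactor (hb : 1 < b) (hne : A.Nonempty) :
    HasDerivAt (eulerFactor b A) (Complex.log b) (s0 b A) := by
  have h := (((hasDerivAt_neg (s0 b A : ℂ)).const_cpow
    (Or.inl (base_cast_ne_zero hb))).const_mul (A.card : ℂ)).const_sub 1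
  refine h.congr_deriv ?_
  have h1 := card_mul_cpow_neg hb hne 0
  simp only [Nat.cast_zero, sub_zero, pow_zero] at h1
  linear_combination (Complex.log b) * h1

theorem eulerFactor_s0_sub (hb : 1 < b) (hne : A.Nonempty) (m : ℕ) :
    eulerFactor b A ((s0 b A : ℂ) - m) = 1 - (b : ℂ) ^ m := by
  rw [eulerFactor, card_mul_cpow_neg hb hne]

theorem one_sub_pow_ne_zero (hb : 1 < b) {m : ℕ} (hm : m ≠ 0) : 1 - (b : ℂ) ^ m ≠ 0 := by
  rw [sub_ne_zero]
  exact_mod_cast (Nat.one_lt_pow hm hb).ne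

/-- A lower bound for the restricted Dirichlet series near its abscissa of convergence. -/
theorem rpow_neg_le_mul_tsum (hb : 1 < b) (hAb : ∀ a ∈ A, a < b) (hA : ∃ a ∈ A, a ≠ 0) {x : ℝ}
    (hx : s0 b A < x) : (b : ℝ) ^ (-x) ≤
      (1 - A.card * (b : ℝ) ^ (-x)) * ∑' n : ℕ, weight b A n * (n : ℝ) ^ (-x) := by
  have hne : A.Nonempty := hA.imp fun _ h => h.1
  have hx0 : 0 < x := (s0_nonneg hb hne).trans_lt hx
  have hb0 : (0 : ℝ) < b := by positivity
  have hsum := summable_weight_rpow hb hAb hne hx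
  have hq := card_mul_rpow_neg_lt_one hb hne hx
  have hle : ∀ n : ℕ, weight b A n • ((n : ℝ) + 1) ^ (-x) ≤ weight b A n * (n : ℝ) ^ (-x) := by
    intro n
    rcases Nat.eq_zero_or_pos n with rfl | hn
    · simp
    · have hn' : (0 : ℝ) < n := by exact_mod_cast hn
      exact mul_le_mul_of_nonneg_left
        (Real.rpow_le_rpow_of_nonpos hn' (by linarith) (by linarith)) (weight_nonneg n)
  have hsum' : Summable fun n : ℕ => weight b A n • ((n : ℝ) + 1) ^ (-x) :=
    Summable.of_nonneg_of_le (fun n => mul_nonneg (weight_nonneg n) (by positivity)) hle hsum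
  -- The shift to `n + 1` gives the comparison the right direction: `a + b n + 1 ≤ b (n + 1)` for
  -- every digit, so splitting yields `(1 - N b^(-x)) S ≥ ∑ (a + 1)^(-x) ≥ b^(-x)`.
  set S := ∑' n : ℕ, weight b A n • ((n : ℝ) + 1) ^ (-x) with hS
  have h1 := hasSum_weight_split hb hAb (f := fun n : ℕ => ((n : ℝ) + 1) ^ (-x)) hsum'.hasSum
  have h2 : (A.card * (b : ℝ) ^ (-x)) * S ≤ S - ∑ a ∈ A.erase 0, ((a : ℝ) + 1) ^ (-x) := by
    refine hasSum_le (fun n => ?_) (hsum'.hasSum.mul_left (A.card * (b : ℝ) ^ (-x))) h1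
    rw [smul_eq_mul, smul_eq_mul, mul_left_comm]
    refine mul_le_mul_of_nonneg_left ?_ (weight_nonneg n)
    rw [mul_assoc, ← nsmul_eq_mul, ← Finset.sum_const]
    refine Finset.sum_le_sum fun a ha => ?_
    rw [← Real.mul_rpow hb0.le (by positivity)]
    refine Real.rpow_le_rpow_of_nonpos (by positivity) ?_ (by linarith)
    have h3 : (a : ℝ) + 1 ≤ b := by exact_mod_cast hAb a ha
    push_cast
    linarith
  have h4 : (b : ℝ) ^ (-x) ≤ ∑ a ∈ A.erase 0, ((a : ℝ) + 1) ^ (-x) := by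
    obtain ⟨a, ha, ha0⟩ := hA
    have h3 : (a : ℝ) + 1 ≤ b := by exact_mod_cast hAb a ha
    exact (Real.rpow_le_rpow_of_nonpos (by positivity) h3 (by linarith)).trans
      (Finset.single_le_sum (f := fun a : ℕ => ((a : ℝ) + 1) ^ (-x))
        (fun a _ => by positivity) (Finset.mem_erase.2 ⟨ha0, ha⟩))
  have h5 : S ≤ ∑' n : ℕ, weight b A n * (n : ℝ) ^ (-x) := hsum'.tsum_le_tsum hle hsum
  have h6 := mul_le_mul_of_nonneg_left h5 (sub_nonneg.2 hq.le)
  linarith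

theorem dirichletSum_ofReal (hb : 1 < b) (hAb : ∀ a ∈ A, a < b) (hne : A.Nonempty) {x : ℝ}
    (hx : s0 b A < x) :
    dirichletSum b A x = ((∑' n : ℕ, weight b A n * (n : ℝ) ^ (-x) : ℝ) : ℂ) := by
  rw [← (hasSum_dirichletSum hb hAb hne (s := x) (by simpa using hx)).tsum_eq, Complex.ofReal_tsum]
  refine tsum_congr fun n => ?_
  rw [Complex.ofReal_mul, Complex.ofReal_cpow (by positivity), Complex.real_smul]
  push_cast
  rfl

theorem rpow_neg_le_re (hb : 1 < b) (hAb : ∀ a ∈ A, a < b) (hA : ∃ a ∈ A, a ≠ 0) {x : ℝ}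
    (hx : s0 b A < x) : (b : ℝ) ^ (-x) ≤ (eulerFactor b A x * dirichletSum b A x).re := by
  have hne : A.Nonempty := hA.imp fun _ h => h.1
  have h : eulerFactor b A x = ((1 - A.card * (b : ℝ) ^ (-x) : ℝ) : ℂ) := by
    rw [eulerFactor]
    push_cast
    rw [Complex.ofReal_cpow (by positivity)]
    push_cast
    rfl
  rw [h, dirichletSum_ofReal hb hAb hne hx, ← Complex.ofReal_mul, Complex.ofReal_re]
  exact rpow_neg_le_mul_tsum hb hAb hA hx

/-- The continuation has a pole at `s₀`, which is simple. -/
theorem exists_hasSimplePole_s0 (hb : 1 < b) (hAb : ∀ a ∈ A, a < b) (hA : ∃ a ∈ A, a ≠ 0) :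
    ∃ c, c ≠ 0 ∧ HasSimplePole (continuation b A) (s0 b A) c := by
  have hne : A.Nonempty := hA.imp fun _ h => h.1
  have hbR : (1 : ℝ) < b := by exact_mod_cast hb
  obtain ⟨T, hT, hev⟩ := exists_local_functional hb hAb hne 0 (z := (s0 b A : ℂ))
    (by simp only [Complex.ofReal_re]; push_cast; linarith)
  simp only [Finset.range_zero, Finset.sum_empty, add_zero] at hev
  -- Writes the Euler factor as `(s - s₀) u(s)` with `u(s₀) = log b ≠ 0`, so its zero at `s₀` is
  -- simple.
  set u : ℂ → ℂ := dslope (eulerFactor b A) (s0 b A) with hu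
  have hu0 : u (s0 b A) ≠ 0 := by
    rw [hu, dslope_same, (hasDerivAt_eulerFactor hb hne).deriv]
    have h1 : Complex.log b = (Real.log b : ℂ) := by
      rw [← Complex.ofReal_natCast, Complex.ofReal_log (by positivity)]
    rw [h1]
    exact_mod_cast (Real.log_pos hbR).ne'
  have huan : AnalyticAt ℂ u (s0 b A) := by
    have h1 : DifferentiableOn ℂ u Set.univ :=
      (Complex.differentiableOn_dslope Filter.univ_mem).2
        (differentiable_eulerFactor hb).differentiableOn
    exact h1.analyticAt Filter.univ_mem
  have hfac : ∀ s, eulerFactor b A s = (s - s0 b A) * u s := fun s => by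
    have h1 := sub_smul_dslope (eulerFactor b A) (s0 b A : ℂ) s
    have h2 := eulerFactor_s0_sub (A := A) hb hne 0
    simp only [Nat.cast_zero, sub_zero, pow_zero, sub_self] at h2
    rw [h2, sub_zero, smul_eq_mul] at h1
    exact h1.symm
  -- To the right of `s₀` on the real axis, `T` is the Euler factor times the Dirichlet series. Its
  -- lower bound `b^(-x)` survives the limit `x → s₀`, so the pole does not cancel.
  have hT0 : 0 < (T (s0 b A)).re := by
    have h1 : Tendsto (fun x : ℝ => (T x).re) (𝓝[>] (s0 b A)) (𝓝 (T (s0 b A)).re) := by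
      refine Tendsto.mono_left ?_ nhdsWithin_le_nhds
      have h2 : ContinuousAt (fun x : ℝ => T x) (s0 b A) :=
        ContinuousAt.comp (f := fun x : ℝ => (x : ℂ)) hT.continuousAt
          Complex.continuous_ofReal.continuousAt
      exact (Complex.continuous_re.tendsto _).comp h2
    have h2 : Tendsto (fun x : ℝ => (b : ℝ) ^ (-x)) (𝓝[>] (s0 b A))
        (𝓝 ((b : ℝ) ^ (-(s0 b A)))) := by
      refine Tendsto.mono_left ?_ nhdsWithin_le_nhds
      exact (continuous_const.rpow continuous_neg
        (fun _ => Or.inl (by positivity))).tendsto _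
    refine lt_of_lt_of_le (by positivity) (le_of_tendsto_of_tendsto h2 h1 ?_)
    have h3 := (Complex.continuous_ofReal.tendsto (s0 b A)).eventually hev
    filter_upwards [h3.filter_mono nhdsWithin_le_nhds, self_mem_nhdsWithin] with x hx1 hx2
    have hx2' : s0 b A < (x : ℂ).re := hx2
    have h4 : T x = eulerFactor b A x * dirichletSum b A x := by
      rw [← continuation_eq_dirichletSum hb hAb hne hx2', hx1,
        mul_inv_cancel_left₀ (eulerFactor_ne_zero hb hne hx2')]
    rw [h4]
    exact rpow_neg_le_re hb hAb hA hx2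
  refine ⟨(u (s0 b A))⁻¹ * T (s0 b A), mul_ne_zero (inv_ne_zero hu0) ?_,
    fun s => (u s)⁻¹ * T s, (huan.inv hu0).mul hT, rfl, ?_⟩
  · intro h
    rw [h] at hT0
    simp at hT0
  · filter_upwards [hev.filter_mono nhdsWithin_le_nhds] with s hs
    rw [hs, hfac, mul_inv, mul_assoc]

/-- For `m ≥ 1` the Euler factor equals `1 - b ^ m ≠ 0` at `s₀ - m`, so any pole is inherited from
the earlier points `s₀ - m + (j + 1) = s₀ - (m - 1 - j)`. -/
theorem hasSimplePole_s0_sub_of_lt (hb : 1 < b) (hAb : ∀ a ∈ A, a < b) (hne : A.Nonempty)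
    {m : ℕ} (hm : m ≠ 0) {r : ℕ → ℂ}
    (hr : ∀ k < m, HasSimplePole (continuation b A) ((s0 b A : ℂ) - k) (r k)) :
    HasSimplePole (continuation b A) ((s0 b A : ℂ) - m) ((1 - (b : ℂ) ^ m)⁻¹ *
      ∑ j ∈ Finset.range m, (b : ℂ) ^ (-((s0 b A : ℂ) - m)) *
        stepCoeff b A ((s0 b A : ℂ) - m) (j + 1) * r (m - 1 - j)) := by
  obtain ⟨T, hT, hev⟩ := exists_local_functional hb hAb hne m (z := (s0 b A : ℂ) - m) (by simp)
  have hfac := eulerFactor_s0_sub (A := A) hb hne m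
  have h1 : AnalyticAt ℂ (fun s => (eulerFactor b A s)⁻¹) ((s0 b A : ℂ) - m) :=
    ((differentiable_eulerFactor hb).analyticAt _).inv
      (by rw [hfac]; exact one_sub_pow_ne_zero hb hm)
  have h2 := (HasSimplePole.of_analyticAt hT).add (HasSimplePole.sum (Finset.range m)
    (F := fun j s => (b : ℂ) ^ (-s) * stepCoeff b A s (j + 1) *
      continuation b A (s + (j + 1 : ℕ)))
    (r := fun j => (b : ℂ) ^ (-((s0 b A : ℂ) - m)) *
        stepCoeff b A ((s0 b A : ℂ) - m) (j + 1) * r (m - 1 - j)) fun j hj => ?_)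
  · have h3 := HasSimplePole.analytic_mul h1 h2
    rw [hfac, zero_add] at h3
    exact h3.congr (hev.filter_mono nhdsWithin_le_nhds)
  · refine HasSimplePole.analytic_mul
      (((differentiable_natCast_cpow_neg (by omega : b ≠ 0)).mul
        (differentiable_stepCoeff (j + 1))).analyticAt _) (HasSimplePole.comp_add_const ?_)
    have hjm := Finset.mem_range.1 hj
    convert hr (m - 1 - j) (by omega) using 1
    have : (m : ℂ) = ((m - 1 - j : ℕ) : ℂ) + (j + 1 : ℕ) := by
      rw [← Nat.cast_add]
      congr 1
      omega
    rw [this]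
    ring

theorem hasSimplePole_s0_sub (hb : 1 < b) (hAb : ∀ a ∈ A, a < b) (hA : ∃ a ∈ A, a ≠ 0)
    (m : ℕ) : HasSimplePole (continuation b A) ((s0 b A : ℂ) - m)
      (residue (continuation b A) ((s0 b A : ℂ) - m)) := by
  have hne : A.Nonempty := hA.imp fun _ h => h.1
  induction m using Nat.strong_induction_on with
  | _ m ih =>
    rcases eq_or_ne m 0 with rfl | hm
    · obtain ⟨c, -, hc⟩ := exists_hasSimplePole_s0 hb hAb hA
      simp only [Nat.cast_zero, sub_zero]
      rwa [hc.residue_eq]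
    · have h := hasSimplePole_s0_sub_of_lt hb hAb hne hm ih
      rwa [h.residue_eq]

theorem residue_recurrence (hb : 1 < b) (hAb : ∀ a ∈ A, a < b) (hA : ∃ a ∈ A, a ≠ 0)
    {m : ℕ} (hm : m ≠ 0) :
    (1 - ((b : ℂ) ^ m)⁻¹) * residue (continuation b A) ((s0 b A : ℂ) - m) =
      -((A.card : ℂ)⁻¹ * ∑ j ∈ Finset.range m, stepCoeff b A ((s0 b A : ℂ) - m) (j + 1) *
        residue (continuation b A) ((s0 b A : ℂ) - (m - 1 - j : ℕ))) := by
  have hne : A.Nonempty := hA.imp fun _ h => h.1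
  have h := (hasSimplePole_s0_sub_of_lt hb hAb hne hm
    fun k _ => hasSimplePole_s0_sub hb hAb hA k).residue_eq
  have hcard : (A.card : ℂ) ≠ 0 := by exact_mod_cast hne.card_pos.ne'
  have hpow : (b : ℂ) ^ (-((s0 b A : ℂ) - m)) = (A.card : ℂ)⁻¹ * (b : ℂ) ^ m := by
    rw [← card_mul_cpow_neg (A := A) hb hne, inv_mul_cancel_left₀ hcard]
  have hb0 : (b : ℂ) ^ m ≠ 0 := pow_ne_zero _ (base_cast_ne_zero hb)
  have h1 := one_sub_pow_ne_zero hb hm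
  rw [h, hpow]
  simp_rw [mul_assoc]
  rw [← Finset.mul_sum, ← Finset.mul_sum]
  field_simp
  ring

/-! ### The recurrence of the modified residues. -/

/-- The recurrence of the modified residues. -/
def SatisfiesRecurrence (b : ℕ) (A : Finset ℕ) (μ : ℕ → ℂ) : Prop :=
  ∀ m : ℕ, (1 - ((b : ℂ) ^ (m + 1))⁻¹) * μ (m + 1) =
    -((A.card : ℂ)⁻¹ * ∑ i ∈ Finset.range (m + 1),
      (Nat.choose (m + 1) (i + 1) : ℂ) * ((b : ℂ) ^ (i + 1))⁻¹ * powerSum A (i + 1) * μ (m - i))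

theorem one_sub_inv_pow_ne_zero (hb : 1 < b) {m : ℕ} (hm : m ≠ 0) :
    1 - ((b : ℂ) ^ m)⁻¹ ≠ 0 := by
  have h1 := one_sub_pow_ne_zero hb hm
  have hb0 : (b : ℂ) ^ m ≠ 0 := pow_ne_zero _ (base_cast_ne_zero hb)
  intro h
  apply h1
  field_simp at h
  linear_combination -h

theorem satisfiesRecurrence_recurrenceSolution (hb : 1 < b) :
    SatisfiesRecurrence b A (recurrenceSolution b A) := by
  intro m
  rw [recurrenceSolution, mul_inv_cancel_left₀ (one_sub_inv_pow_ne_zero hb (Nat.succ_ne_zero m)),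
    Fin.sum_univ_eq_sum_range (fun i : ℕ => (Nat.choose (m + 1) (i + 1) : ℂ) *
      ((b : ℂ) ^ (i + 1))⁻¹ * powerSum A (i + 1) * recurrenceSolution b A (m - i))]

theorem SatisfiesRecurrence.eq_mul {μ ν : ℕ → ℂ} (hb : 1 < b) (hμ : SatisfiesRecurrence b A μ)
    (hν : SatisfiesRecurrence b A ν) (h0 : ν 0 = 1) (m : ℕ) : μ m = μ 0 * ν m := by
  induction m using Nat.strong_induction_on with
  | _ m ih =>
    rcases m with _ | m
    · rw [h0, mul_one]
    · refine mul_left_cancel₀ (one_sub_inv_pow_ne_zero hb (Nat.succ_ne_zero m)) ?_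
      have hsum : ∑ i ∈ Finset.range (m + 1), (Nat.choose (m + 1) (i + 1) : ℂ) *
          ((b : ℂ) ^ (i + 1))⁻¹ * powerSum A (i + 1) * μ (m - i) =
          μ 0 * ∑ i ∈ Finset.range (m + 1), (Nat.choose (m + 1) (i + 1) : ℂ) *
            ((b : ℂ) ^ (i + 1))⁻¹ * powerSum A (i + 1) * ν (m - i) := by
        rw [Finset.mul_sum]
        refine Finset.sum_congr rfl fun i _ => ?_
        rw [ih (m - i) (by omega)]
        ring
      rw [mul_left_comm, hν m, hμ m, hsum]
      ring

theorem s0_pos (hb : 1 < b) (h1 : 1 < A.card) : 0 < s0 b A :=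
  Real.logb_pos (by exact_mod_cast hb) (by exact_mod_cast h1)

theorem s0_lt_one (hb : 1 < b) (h0 : 0 < A.card) (h1 : A.card < b) : s0 b A < 1 := by
  rw [s0, Real.logb_lt_iff_lt_rpow (by exact_mod_cast hb) (by exact_mod_cast h0), Real.rpow_one]
  exact_mod_cast h1

/-- The factor relating residues and modified residues. -/
def residueFactor (b : ℕ) (A : Finset ℕ) (m : ℕ) : ℂ :=
  -((ascPochhammer ℂ (m + 1)).eval (-(s0 b A : ℂ))) / (m.factorial : ℂ)

/-- Here `0 < s₀ < 1`, so none of the factors `-s₀, 1 - s₀, 2 - s₀, …` vanishes. With `N = 1` or `N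
= b`, `s₀` is `0` or `1` and this fails. -/
theorem residueFactor_ne_zero (hb : 1 < b) (h1 : 1 < A.card) (h2 : A.card < b) (m : ℕ) :
    residueFactor b A m ≠ 0 := by
  have hpos := s0_pos hb h1
  have hlt := s0_lt_one hb (by omega) h2
  refine div_ne_zero (neg_ne_zero.2 fun h => ?_) (by exact_mod_cast m.factorial_ne_zero)
  obtain ⟨k, -, hk⟩ := (ascPochhammer_eval_eq_zero_iff _ _).1 h
  have hk' : s0 b A = k := by
    have : (s0 b A : ℂ) = k := by linear_combination -hk
    exact_mod_cast this
  rw [hk'] at hpos hlt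
  have : 0 < k := by exact_mod_cast hpos
  have : k < 1 := by exact_mod_cast hlt
  omega

theorem ascPochhammer_eval_mul_prod (x : ℂ) {m i : ℕ} (hi : i ≤ m) :
    (ascPochhammer ℂ (m - i + 1)).eval (-x) * ∏ l ∈ Finset.range i, ((m : ℂ) - x - l) =
      (ascPochhammer ℂ (m + 1)).eval (-x) := by
  induction i with
  | zero => simp
  | succ i ih =>
    rw [← ih (by omega), Finset.prod_range_succ]
    obtain ⟨k, hk⟩ := Nat.exists_eq_add_of_le hi
    have e1 : m - (i + 1) + 1 = k + 1 := by omega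
    have e2 : m - i + 1 = k + 1 + 1 := by omega
    rw [e1, e2, ascPochhammer_succ_eval (k + 1), hk]
    push_cast
    ring

/-- The numerator of the generalised binomial coefficient is, up to sign, the top `i` factors of
`(-s₀)_{m+1}`. The smaller Pochhammer symbol supplies the others, and the factorials combine to `m
choose i`. -/
theorem choose_mul_residueFactor {m i : ℕ} (hi : i ≤ m) :
    Ring.choose (-((s0 b A : ℂ) - m)) i * residueFactor b A (m - i) =
      (Nat.choose m i : ℂ) * residueFactor b A m := by
  have h1 : (Nat.choose m i : ℂ) * (i.factorial : ℂ) * ((m - i).factorial : ℂ) = m.factorial := by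
    exact_mod_cast Nat.choose_mul_factorial_mul_factorial hi
  have hm : (m.factorial : ℂ) ≠ 0 := by exact_mod_cast m.factorial_ne_zero
  have hif : (i.factorial : ℂ) ≠ 0 := by exact_mod_cast i.factorial_ne_zero
  have hmi : ((m - i).factorial : ℂ) ≠ 0 := by exact_mod_cast (m - i).factorial_ne_zero
  have h2 : (-1 : ℂ) ^ i * ∏ l ∈ Finset.range i, ((s0 b A : ℂ) - m + l) =
      ∏ l ∈ Finset.range i, ((m : ℂ) - s0 b A - l) := by
    rw [← Finset.card_range i, ← Finset.prod_const, Finset.card_range, ← Finset.prod_mul_distrib]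
    exact Finset.prod_congr rfl fun l _ => by ring
  rw [choose_neg_eq_prod, h2, residueFactor, residueFactor,
    ← ascPochhammer_eval_mul_prod (s0 b A : ℂ) hi, ← h1]
  have hc : (Nat.choose m i : ℂ) ≠ 0 := by exact_mod_cast (Nat.choose_pos hi).ne'
  field_simp

theorem modifiedResidue_of_not (K : ℂ → ℂ) (h : ¬ (A.card = 1 ∨ A.card = b)) (m : ℕ) :
    modifiedResidue b A K m = residue K ((s0 b A : ℂ) - m) / residueFactor b A m := by
  rw [modifiedResidue, if_neg h, residueFactor]

theorem IsContinuation.residue_eq (hb : 1 < b) (hAb : ∀ a ∈ A, a < b) (hA : ∃ a ∈ A, a ≠ 0)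
    {K : ℂ → ℂ} (hK : IsContinuation b A K) (m : ℕ) :
    residue K ((s0 b A : ℂ) - m) = residue (continuation b A) ((s0 b A : ℂ) - m) :=
  ((hasSimplePole_s0_sub hb hAb hA m).congr
    (hK.eventuallyEq hb hAb (hA.imp fun _ h => h.1) _)).residue_eq

theorem one_lt_card_lt (hAb : ∀ a ∈ A, a < b) (hne : A.Nonempty)
    (h : ¬ (A.card = 1 ∨ A.card = b)) : 1 < A.card ∧ A.card < b := by
  have h1 : A.card ≤ b := by
    simpa using Finset.card_le_card (fun a ha => Finset.mem_range.2 (hAb a ha) :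
      A ⊆ Finset.range b)
  have := hne.card_pos
  omega

theorem modifiedResidue_zero_ne_zero (hb : 1 < b) (hAb : ∀ a ∈ A, a < b)
    (hA : ∃ a ∈ A, a ≠ 0) {K : ℂ → ℂ} (hK : IsContinuation b A K) :
    modifiedResidue b A K 0 ≠ 0 := by
  by_cases h : A.card = 1 ∨ A.card = b
  · simp [modifiedResidue, h, recurrenceSolution]
  · obtain ⟨h1, h2⟩ := one_lt_card_lt hAb (hA.imp fun _ h => h.1) h
    rw [modifiedResidue_of_not K h, hK.residue_eq hb hAb hA]
    refine div_ne_zero ?_ (residueFactor_ne_zero hb h1 h2 0)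
    obtain ⟨c, hc0, hc⟩ := exists_hasSimplePole_s0 hb hAb hA
    rwa [Nat.cast_zero, sub_zero, hc.residue_eq]

theorem satisfiesRecurrence_modifiedResidue (hb : 1 < b) (hAb : ∀ a ∈ A, a < b)
    (hA : ∃ a ∈ A, a ≠ 0) {K : ℂ → ℂ} (hK : IsContinuation b A K) :
    SatisfiesRecurrence b A (modifiedResidue b A K) := by
  by_cases h : A.card = 1 ∨ A.card = b
  · have : modifiedResidue b A K = recurrenceSolution b A := by
      ext m
      rw [modifiedResidue, if_pos h]
    rw [this]
    exact satisfiesRecurrence_recurrenceSolution hb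
  · obtain ⟨h1, h2⟩ := one_lt_card_lt hAb (hA.imp fun _ h => h.1) h
    intro m
    have hD := residueFactor_ne_zero hb h1 h2
    have hrec := residue_recurrence hb hAb hA (Nat.succ_ne_zero m)
    simp_rw [← hK.residue_eq hb hAb hA] at hrec
    have hres : ∀ k : ℕ, residue K ((s0 b A : ℂ) - k) =
        modifiedResidue b A K k * residueFactor b A k := fun k => by
      rw [modifiedResidue_of_not K h, div_mul_cancel₀ _ (hD k)]
    simp only [hres, Nat.succ_eq_add_one, Nat.add_sub_cancel] at hrec
    refine mul_right_cancel₀ (hD (m + 1)) ?_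
    rw [mul_assoc, hrec, neg_mul, mul_assoc, Finset.sum_mul]
    congr 2
    refine Finset.sum_congr rfl fun i hi => ?_
    have him : i + 1 ≤ m + 1 := by have := Finset.mem_range.1 hi; omega
    have hc := choose_mul_residueFactor (b := b) (A := A) him
    rw [Nat.add_sub_add_right] at hc
    rw [stepCoeff]
    linear_combination
      ((b : ℂ) ^ (i + 1))⁻¹ * powerSum A (i + 1) * modifiedResidue b A K (m - i) * hc

end Residues

/-! ### Taylor coefficients and poles of the inverse of `E`. -/

section InverseMGF

variable {b : ℕ} {A : Finset ℕ}

theorem iteratedDeriv_comp_mul_left (m : ℕ) (f : ℂ → ℂ) (c x : ℂ) :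
    iteratedDeriv m (fun t => f (c * t)) x = c ^ m * iteratedDeriv m f (c * x) := by
  induction m generalizing f with
  | zero => simp
  | succ m ih =>
    have h : deriv (fun t => f (c * t)) = fun t => c * deriv f (c * t) := by
      ext t
      rw [deriv_comp_mul_left, smul_eq_mul]
    rw [iteratedDeriv_succ', h, iteratedDeriv_const_mul_field, ih, iteratedDeriv_succ', pow_succ']
    ring

theorem iteratedDeriv_digitMGF_zero (m : ℕ) :
    iteratedDeriv m (digitMGF A) 0 = (A.card : ℂ)⁻¹ * powerSum A m := by
  have h : digitMGF A = fun t => (A.card : ℂ)⁻¹ * ∑ a ∈ A, Complex.exp (a * t) := by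
    ext t
    rw [digitMGF, div_eq_inv_mul]
  rw [h, iteratedDeriv_const_mul_field, powerSum]
  congr 1
  rw [iteratedDeriv_fun_sum fun a _ => by fun_prop]
  simp

theorem satisfiesRecurrence_iteratedDeriv (hb : 1 < b) (hAb : ∀ a ∈ A, a < b)
    (hne : A.Nonempty) :
    SatisfiesRecurrence b A (fun m => iteratedDeriv m (cantorMGF b A)⁻¹ 0) := by
  intro m
  have hE := differentiable_cantorMGF hb hAb hne
  have hE0 := cantorMGF_zero hb hAb hne
  have hcard : (A.card : ℂ) ≠ 0 := by exact_mod_cast hne.card_pos.ne'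
  have hB : AnalyticAt ℂ (cantorMGF b A)⁻¹ 0 := (hE.analyticAt 0).inv (by simp [hE0])
  have hP : AnalyticAt ℂ (fun t => digitMGF A ((b : ℂ)⁻¹ * t)) 0 :=
    (differentiable_digitMGF.comp (differentiable_id.const_mul (b : ℂ)⁻¹)).analyticAt 0
  have hev : (fun t => digitMGF A ((b : ℂ)⁻¹ * t) * (cantorMGF b A)⁻¹ t) =ᶠ[𝓝 0]
      fun t => (cantorMGF b A)⁻¹ ((b : ℂ)⁻¹ * t) := by
    filter_upwards [hE.continuous.continuousAt.eventually_ne (by simp [hE0] : cantorMGF b A 0 ≠ 0)]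
      with t ht
    have hf := cantorMGF_functional hb hAb hne t
    rw [div_eq_inv_mul] at hf
    have h1 : digitMGF A ((b : ℂ)⁻¹ * t) ≠ 0 := fun h => ht (by rw [hf, h, zero_mul])
    rw [Pi.inv_apply, Pi.inv_apply, hf, mul_inv, mul_inv_cancel_left₀ h1]
  -- Leibniz on the left, scaling by `b ^ (-(m + 1))` on the right. The `i = 0` term is the
  -- derivative of order `m + 1` of `1/E` itself and joins the right-hand side to form `1 - b ^ (-(m
  -- + 1))`.
  have hder := hev.iteratedDeriv_eq (m + 1)
  rw [iteratedDeriv_fun_mul hP.contDiffAt hB.contDiffAt, iteratedDeriv_comp_mul_left,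
    Finset.sum_range_succ'] at hder
  simp only [iteratedDeriv_comp_mul_left, mul_zero, iteratedDeriv_digitMGF_zero, pow_zero,
    Nat.choose_zero_right, Nat.cast_one, one_mul, Nat.sub_zero, Nat.add_sub_add_right] at hder
  have h0 : powerSum A 0 = A.card := by simp [powerSum]
  rw [h0, inv_mul_cancel₀ hcard, one_mul] at hder
  have hsum : ∑ i ∈ Finset.range (m + 1), (Nat.choose (m + 1) (i + 1) : ℂ) *
        ((b : ℂ)⁻¹ ^ (i + 1) * ((A.card : ℂ)⁻¹ * powerSum A (i + 1))) *
          iteratedDeriv (m - i) (cantorMGF b A)⁻¹ 0 =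
      (A.card : ℂ)⁻¹ * ∑ i ∈ Finset.range (m + 1), (Nat.choose (m + 1) (i + 1) : ℂ) *
        ((b : ℂ) ^ (i + 1))⁻¹ * powerSum A (i + 1) *
          iteratedDeriv (m - i) (cantorMGF b A)⁻¹ 0 := by
    rw [Finset.mul_sum]
    refine Finset.sum_congr rfl fun i _ => ?_
    rw [inv_pow]
    ring
  rw [hsum, inv_pow] at hder
  linear_combination hder

theorem hasSum_inv_cantorMGF (hb : 1 < b) (hAb : ∀ a ∈ A, a < b) (hA : ∃ a ∈ A, a ≠ 0)
    {K : ℂ → ℂ} (hK : IsContinuation b A K) {r : ℝ}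
    (hr : ∀ t : ℂ, ‖t‖ < r → cantorMGF b A t ≠ 0) {t : ℂ} (ht : ‖t‖ < r) :
    HasSum (fun m : ℕ => (modifiedResidue b A K 0)⁻¹ *
      (modifiedResidue b A K m / (m.factorial : ℂ)) * t ^ m) ((cantorMGF b A)⁻¹ t) := by
  have hne : A.Nonempty := hA.imp fun _ h => h.1
  have hd : DifferentiableOn ℂ (cantorMGF b A)⁻¹ (Metric.ball 0 r) := fun s hs =>
    ((differentiable_cantorMGF hb hAb hne s).inv
      (hr s (by simpa using hs))).differentiableWithinAt
  refine (Complex.hasSum_taylorSeries_on_ball hd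
    (by simpa using ht : t ∈ Metric.ball 0 r)).congr_fun fun m => ?_
  rw [(satisfiesRecurrence_modifiedResidue hb hAb hA hK).eq_mul hb
    (satisfiesRecurrence_iteratedDeriv hb hAb hne) (by simp [cantorMGF_zero hb hAb hne]) m]
  have h0 := modifiedResidue_zero_ne_zero hb hAb hA hK
  simp only [sub_zero, smul_eq_mul]
  field_simp

/-- Since `E(0) = 1`, `E` is not identically zero, so its order at a zero is finite and positive;
inversion changes the sign. -/
theorem meromorphicOrderAt_inv_cantorMGF_neg (hb : 1 < b) (hAb : ∀ a ∈ A, a < b)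
    (hne : A.Nonempty) {t : ℂ} (ht : cantorMGF b A t = 0) :
    meromorphicOrderAt (cantorMGF b A)⁻¹ t < 0 := by
  have hE := differentiable_cantorMGF hb hAb hne
  have han : AnalyticAt ℂ (cantorMGF b A) t := hE.analyticAt t
  have hpos : 0 < meromorphicOrderAt (cantorMGF b A) t := by
    rw [han.meromorphicOrderAt_eq]
    have h1 : analyticOrderAt (cantorMGF b A) t ≠ 0 := by
      rw [Ne, han.analyticOrderAt_eq_zero]
      simp [ht]
    cases h : analyticOrderAt (cantorMGF b A) t with
    | top => simp
    | coe n =>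
      have hn : n ≠ 0 := by rintro rfl; exact h1 h
      simpa using Nat.pos_of_ne_zero hn
  have htop : meromorphicOrderAt (cantorMGF b A) t ≠ ⊤ := by
    have hmer : Meromorphic (cantorMGF b A) := fun z => (hE.analyticAt z).meromorphicAt
    refine hmer.exists_meromorphicOrderAt_ne_top_iff_forall.1 ⟨0, ?_⟩ t
    rw [(hE.analyticAt 0).meromorphicOrderAt_eq,
      (hE.analyticAt 0).analyticOrderAt_eq_zero.2 (by simp [cantorMGF_zero hb hAb hne])]
    simp
  rw [meromorphicOrderAt_inv]
  lift meromorphicOrderAt (cantorMGF b A) t to ℤ using htop with n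
  have hn : 0 < n := by exact_mod_cast hpos
  exact_mod_cast neg_neg_of_pos hn

end InverseMGF

end

end RestrictedDirichlet

/-! ### The main theorem. -/

theorem mainTheorem4 (b : ℕ) (hb : 1 < b) (A : Finset ℕ) (hAb : ∀ a ∈ A, a < b)
    (hA : ∃ a ∈ A, a ≠ 0) :
    -- the canonical measure is a probability measure, supported by the Cantor set
    (IsProbabilityMeasure (RestrictedDirichlet.cantorMeasure b A) ∧
      (RestrictedDirichlet.cantorMeasure b A).support = RestrictedDirichlet.cantorSet b A) ∧
    -- its moment generating function is entire, and is the infinite product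
    Differentiable ℂ (RestrictedDirichlet.cantorMGF b A) ∧
    (∀ t : ℂ, HasProd
      (fun j : ℕ => (∑ a ∈ A, Complex.exp (((b : ℂ) ^ (j + 1))⁻¹ * a * t)) / (A.card : ℂ))
      (RestrictedDirichlet.cantorMGF b A t)) ∧
    -- the restricted Dirichlet series has a meromorphic continuation
    (∃ K : ℂ → ℂ, RestrictedDirichlet.IsContinuation b A K) ∧
    ∀ K : ℂ → ℂ, RestrictedDirichlet.IsContinuation b A K →
      RestrictedDirichlet.modifiedResidue b A K 0 ≠ 0 ∧
      ∃ B : ℂ → ℂ,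
        -- `B` is a meromorphic function on `ℂ`, the sum of the exponential generating series on
        -- every disc around `0` without zeros of `E`, and there is such a disc
        Meromorphic B ∧
        (∃ r : ℝ, 0 < r ∧ ∀ t : ℂ, ‖t‖ < r → RestrictedDirichlet.cantorMGF b A t ≠ 0) ∧
        (∀ r : ℝ, (∀ t : ℂ, ‖t‖ < r → RestrictedDirichlet.cantorMGF b A t ≠ 0) →
          ∀ t : ℂ, ‖t‖ < r →
            HasSum (fun m : ℕ => (RestrictedDirichlet.modifiedResidue b A K 0)⁻¹ *
              (RestrictedDirichlet.modifiedResidue b A K m / (m.factorial : ℂ)) * t ^ m)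
              (B t)) ∧
        -- `B = 1 / E`, with poles exactly at the zeros of `E`
        (∀ t : ℂ, RestrictedDirichlet.cantorMGF b A t ≠ 0 →
          AnalyticAt ℂ B t ∧ B t = (RestrictedDirichlet.cantorMGF b A t)⁻¹ ∧
          Tendsto (fun k : ℕ => (A.card : ℂ) ^ k /
            ∑ a ∈ Fintype.piFinset (fun _ : Fin k => A),
              Complex.exp (t * ∑ j : Fin k, ((b : ℂ) ^ (j.val + 1))⁻¹ * (a j : ℂ)))
            atTop (𝓝 (B t))) ∧
        (∀ t : ℂ, RestrictedDirichlet.cantorMGF b A t = 0 → meromorphicOrderAt B t < 0) ∧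
        -- `|B| > 1` on the left half-plane (with `|B| = ∞` at the poles)
        (∀ t : ℂ, t.re < 0 → ‖RestrictedDirichlet.cantorMGF b A t‖ < 1 ∧
          (RestrictedDirichlet.cantorMGF b A t ≠ 0 → 1 < ‖B t‖)) := by
  open RestrictedDirichlet in
  have hne : A.Nonempty := hA.imp fun _ h => h.1
  have hE := differentiable_cantorMGF hb hAb hne
  have hE0 := cantorMGF_zero hb hAb hne
  refine ⟨⟨isProbabilityMeasure_cantorMeasure hb hAb hne, support_cantorMeasure hb hAb hne⟩, hE,
    fun t => ?_, ⟨continuation b A, isContinuation_continuation hb hAb hne⟩, fun K hK =>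
    -- `B` is the pointwise inverse of `E`. At a zero of `E` it takes the default value `0`, so the
    -- pole is expressed by the meromorphic order.
    ⟨modifiedResidue_zero_ne_zero hb hAb hA hK, (cantorMGF b A)⁻¹,
      fun z => (hE.analyticAt z).meromorphicAt.inv, ?_,
      fun r hr t ht => hasSum_inv_cantorMGF hb hAb hA hK hr ht, fun t ht =>
      ⟨(hE.analyticAt t).inv ht, rfl, ?_⟩,
      fun t ht => meromorphicOrderAt_inv_cantorMGF_neg hb hAb hne ht, fun t ht =>
      ⟨norm_cantorMGF_lt_one hb hAb hA ht, fun h0 => ?_⟩⟩⟩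
  · refine (hasProd_cantorMGF hb hAb hne t).congr_fun fun j => ?_
    rw [digitMGF]
    congr 1
    refine Finset.sum_congr rfl fun a _ => ?_
    congr 1
    ring
  · have h := hE.continuous.continuousAt.eventually_ne (by simp [hE0] : cantorMGF b A 0 ≠ 0)
    obtain ⟨r, hr, h⟩ := Metric.eventually_nhds_iff.1 h
    exact ⟨r, hr, fun t ht => h (by simpa using ht)⟩
  · refine ((tendsto_prod_digitMGF hb hAb hne t).inv₀ ht).congr fun k => ?_
    exact prod_digitMGF_eq t k
  · rw [Pi.inv_apply, norm_inv]
    exact (one_lt_inv₀ (norm_pos_iff.2 h0)).2 (norm_cantorMGF_lt_one hb hAb hA ht)
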